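/- All graphs are finite, simple and undirected. For a graph $G$ and $X\subseteq V(G)$ let $N_G(X)=\bigcup_{x\in X}N_G(x)$. The binding number of $G$ is $$\mathrm{bind}(G)=\min\left\{\frac{|N_G(X)|}{|X|}:\ \emptyset\neq X\subseteq V(G),\ N_G(X)\neq V(G)\right\},$$ and $G$ is called $r$-binding if $\mathrm{bind}(G)\ge r$. Let $\rho(G)$ denote the largest eigenvalue of the adjacency matrix of $G$. Let $\cup$ denote disjoint union, $tH$ the disjoint union of $t$ copies of $H$, and $\vee$ the join (disjoint union together with all edges between the two parts). A spanning $k$-tree of $G$ is a spanning tree $T$ of $G$ with $d_T(v)\le k$ for every vertex $v$. Theorem. Let $k\ge 3$ be an integer and let $G$ be a connected $\frac{1}{k-2}$-binding graph of order $n\ge 2k+22$. If $$\rho(G)\ \ge\ \rho\bigl(K_1\vee(K_{n-k-3}\cup 2K_2\cup (k-2)K_1)\bigr),$$ then $G$ has a spanning $k$-tree, unless $G\cong K_1\vee(K_{n-k-3}\cup 2K_2\cup (k-2)K_1)$, in which case $G$ has no spanning $k$-tree. -/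

import Mathlib

namespace SpanningKTree

/-- The neighbourhood `N_G(X) = ⋃_{x ∈ X} N_G(x)` of a set `X` of vertices. -/
def nbhd {V : Type*} (G : SimpleGraph V) (X : Set V) : Set V :=
  ⋃ x ∈ X, G.neighborSet x

/-- The ratios `|N_G(X)| / |X|` over nonempty `X ⊆ V(G)` with `N_G(X) ≠ V(G)`. -/
def bindingRatios {V : Type*} (G : SimpleGraph V) : Set ℝ :=
  {r | ∃ X : Set V, X.Nonempty ∧ nbhd G X ≠ Set.univ ∧
    r = ((nbhd G X).ncard : ℝ) / (X.ncard : ℝ)}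

/-- The binding number: the least of the ratios (for a finite nonempty graph the minimum
is attained, see `isLeast_bindingNumber`). -/
noncomputable def bindingNumber {V : Type*} (G : SimpleGraph V) : ℝ :=
  sInf (bindingRatios G)

/-- `G` is `r`-binding if its binding number is at least `r`. -/
def IsBinding {V : Type*} (r : ℝ) (G : SimpleGraph V) : Prop :=
  r ≤ bindingNumber G

theorem isLeast_bindingNumber {V : Type*} [Finite V] [Nonempty V] (G : SimpleGraph V) :
    IsLeast (bindingRatios G) (bindingNumber G) := by
  have hfin : (bindingRatios G).Finite := by
    refine (Set.finite_range
      (fun X : Set V => ((nbhd G X).ncard : ℝ) / (X.ncard : ℝ))).subset ?_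
    rintro r ⟨X, -, -, rfl⟩
    exact ⟨X, rfl⟩
  have hne : (bindingRatios G).Nonempty := by
    obtain ⟨v⟩ := ‹Nonempty V›
    refine ⟨_, {v}, Set.singleton_nonempty v, ?_, rfl⟩
    intro h
    have hv : v ∈ nbhd G {v} := h ▸ Set.mem_univ v
    simp [nbhd] at hv
  exact ⟨hne.csInf_mem hfin, fun r hr => csInf_le hfin.bddBelow hr⟩

open Classical in
/-- The set of (real) eigenvalues of the adjacency matrix of `G`. -/
def adjEigenvalues {V : Type*} [Fintype V] (G : SimpleGraph V) : Set ℝ :=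
  {μ | Module.End.HasEigenvalue (Matrix.toLin' (G.adjMatrix ℝ)) μ}

/-- The adjacency spectral radius: the largest eigenvalue of the adjacency matrix
(for a nonempty graph it is attained, see `isGreatest_rho`). -/
noncomputable def rho {V : Type*} [Fintype V] (G : SimpleGraph V) : ℝ :=
  sSup (adjEigenvalues G)

theorem isGreatest_rho {V : Type*} [Fintype V] [Nonempty V] (G : SimpleGraph V) :
    IsGreatest (adjEigenvalues G) (rho G) := by
  classical
  have hfin : (adjEigenvalues G).Finite := Module.End.finite_hasEigenvalue _
  have hne : (adjEigenvalues G).Nonempty := by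
    have hA : (G.adjMatrix ℝ).IsHermitian := by
      ext i j
      simp [Matrix.conjTranspose_apply, SimpleGraph.adjMatrix_apply, SimpleGraph.adj_comm]
    obtain ⟨v⟩ := ‹Nonempty V›
    refine ⟨hA.eigenvalues v, ?_⟩
    have h := hA.eigenvalues_mem_spectrum_real v
    rw [← Matrix.spectrum_toLin', ← Module.End.hasEigenvalue_iff_mem_spectrum] at h
    change Module.End.HasEigenvalue _ _
    convert h
  exact ⟨hne.csSup_mem hfin, fun r hr => le_csSup hfin.bddAbove hr⟩

open Classical in
/-- `G` has a spanning `k`-tree: a spanning tree of maximum degree at most `k`. -/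
def HasSpanningKTree {V : Type*} [Fintype V] (k : ℕ) (G : SimpleGraph V) : Prop :=
  ∃ T : SimpleGraph V, T ≤ G ∧ T.IsTree ∧ ∀ v, T.degree v ≤ k

/-- The join `G ∨ H`: the disjoint union together with all edges between the two parts. -/
def join {V W : Type*} (G : SimpleGraph V) (H : SimpleGraph W) : SimpleGraph (V ⊕ W) :=
  SimpleGraph.sum G H ⊔ completeBipartiteGraph V W

/-- The disjoint union `tG` of `t` copies of `G`. -/
def copies {V : Type*} (t : ℕ) (G : SimpleGraph V) : SimpleGraph (Fin t × V) where
  Adj p q := p.1 = q.1 ∧ G.Adj p.2 q.2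
  symm := ⟨fun _ _ h => ⟨h.1.symm, h.2.symm⟩⟩
  loopless := ⟨fun _ h => G.irrefl h.2⟩

/-- The complete graph `K_m`. -/
abbrev K (m : ℕ) : SimpleGraph (Fin m) := ⊤

/-- The graph `K_1 ∨ (K_{n-k-3} ∪ 2K_2 ∪ (k-2)K_1)`; it has order `n` if `k ≥ 2` and
`n ≥ k + 3`. -/
abbrev extremalGraph (n k : ℕ) :
    SimpleGraph (Fin 1 ⊕ ((Fin (n - k - 3) ⊕ (Fin 2 × Fin 2)) ⊕ (Fin (k - 2) × Fin 1))) :=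
  join (K 1) (SimpleGraph.sum (SimpleGraph.sum (K (n - k - 3)) (copies 2 (K 2)))
    (copies (k - 2) (K 1)))

end SpanningKTree

/-! Suppose $G$ has no spanning $k$-tree. Win's theorem
(`exists_card_connectedComponent_of_not_hasSpanningKTree`) gives a nonempty set $S$ of $s$ vertices
such that $G-S$ has at least $(k-2)s+3$ components. The isolated vertices of $G-S$ have all their
neighbours in $S$, so the binding hypothesis allows at most $(k-2)s$ of them. Hence $G$ lies in the
join of $K_s$ with disjoint cliques whose sizes $a_c$ obey these constraints
(`exists_le_clusterJoin`).

The vector equal to $1$ on $S$ and to $s/(L-a_c)$ on clique $c$ satisfies $Ax=(L-1)x$ off $S$, and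
$Ax\le(L-1)x$ on $S$ as soon as $s-1+s\sum_c a_c/(L-a_c)\le L-1$. Being positive, it then forces
$\rho(G)\le L-1$. By convexity of $t/(L-t)$ the sum is largest for $(k-2)s$ ones, two twos and one
large part (`sum_size_div_le`).

If $s=1$, take for $L$ the root of the equation of the extremal graph. Then $\rho(G)\ge L-1$ forces
equality everywhere, and $G$ is the extremal graph. If $s\ge2$, already $L=n-k-2$ works
(`supersolution_bound`), so $\rho(G)\le n-k-3$, which is less than the extremal radius.

The extremal graph itself has no spanning $k$-tree, because its centre needs a tree edge into each
of $k+1$ components. -/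

namespace SpanningKTree
open SimpleGraph

/-! ### Reachability after deleting a set of vertices. -/

section Avoid
variable {V : Type*}

/-- The graph obtained from `G` by deleting every edge that meets `S`, on the same vertex type. -/
def avoid (G : SimpleGraph V) (S : Set V) : SimpleGraph V where
  Adj a b := G.Adj a b ∧ a ∉ S ∧ b ∉ S
  symm := ⟨fun _ _ h => ⟨h.1.symm, h.2.2, h.2.1⟩⟩
  loopless := ⟨fun _ h => G.irrefl h.1⟩

theorem avoid_adj {G : SimpleGraph V} {S : Set V} {a b : V} :
    (avoid G S).Adj a b ↔ G.Adj a b ∧ a ∉ S ∧ b ∉ S := Iff.rfl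

theorem avoid_le (G : SimpleGraph V) (S : Set V) : avoid G S ≤ G := fun _ _ h => h.1

theorem avoid_empty (G : SimpleGraph V) : avoid G ∅ = G := by
  ext a b
  simp [avoid_adj]

theorem avoid_insert (G : SimpleGraph V) (S : Set V) (v : V) :
    avoid G (insert v S) = avoid (avoid G S) {v} := by
  ext a b
  simp only [avoid_adj, Set.mem_insert_iff, Set.mem_singleton_iff]
  tauto

theorem reachable_of_forall_adj {H H' : SimpleGraph V}
    (h : ∀ a b, H.Adj a b → H'.Reachable a b) {a b : V} (hab : H.Reachable a b) :
    H'.Reachable a b := by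
  obtain ⟨p⟩ := hab
  induction p with
  | nil => exact Reachable.rfl
  | cons hadj _ ih => exact (h _ _ hadj).trans ih

theorem exists_last_adj {H : SimpleGraph V} {x v : V} (hx : x ≠ v) (h : H.Reachable x v) :
    ∃ u, (avoid H {v}).Reachable x u ∧ H.Adj u v := by
  obtain ⟨p⟩ := h
  induction p with
  | nil => exact absurd rfl hx
  | @cons a z w hadj p ih =>
    by_cases hz : z = w
    · subst hz
      exact ⟨a, Reachable.rfl, hadj⟩
    · obtain ⟨u, hu, huv⟩ := ih hz
      exact ⟨u, (Adj.reachable (G := avoid H {w}) ⟨hadj, hx, hz⟩).trans hu, huv⟩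

theorem reachable_avoid_or {H : SimpleGraph V} (v : V) {x y : V} (h : H.Reachable x y) :
    (avoid H {v}).Reachable x y ∨ H.Reachable x v := by
  obtain ⟨p⟩ := h
  induction p with
  | nil => exact Or.inl Reachable.rfl
  | @cons a z w hadj p ih =>
    by_cases ha : a = v
    · exact Or.inr (ha ▸ Reachable.rfl)
    by_cases hz : z = v
    · exact Or.inr (hz ▸ hadj.reachable)
    rcases ih with ih | ih
    · exact Or.inl ((Adj.reachable (G := avoid H {v}) ⟨hadj, ha, hz⟩).trans ih)
    · exact Or.inr (hadj.reachable.trans ih)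

theorem avoid_reachable_not_mem {G : SimpleGraph V} {S : Set V} {a b : V} (ha : a ∉ S)
    (h : (avoid G S).Reachable a b) : b ∉ S := by
  obtain ⟨p⟩ := h
  induction p with
  | nil => exact ha
  | cons hadj _ ih => exact ih hadj.2.2

end Avoid

/-! ### The exchange argument behind Win's theorem. -/

section Win
variable {V : Type*}

/-- The connected spanning subgraphs of `G` with degrees bounded by `b` that agree with `T` on the
edges meeting `S` and on the components of the complement of `S`. -/
structure Equivalent (G : SimpleGraph V) (b : V → ℕ) (T : SimpleGraph V) (S : Set V)
    (F : SimpleGraph V) : Prop where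
  le : F ≤ G
  connected : F.Connected
  degree_le : ∀ v, (F.neighborSet v).ncard ≤ b v
  adj_iff : ∀ a ∈ S, ∀ c, F.Adj a c ↔ T.Adj a c
  reachable_iff : ∀ a c, (avoid F S).Reachable a c ↔ (avoid T S).Reachable a c

/-- Sets built up from vertices whose degree meets the bound `b` in all equivalent subgraphs. -/
inductive Tight (G : SimpleGraph V) (b : V → ℕ) (T : SimpleGraph V) : Set V → Prop
  | empty : Tight G b T ∅
  | insert (S : Set V) (v : V) : Tight G b T S → v ∉ S →
      (∀ F, Equivalent G b T S F → (F.neighborSet v).ncard = b v) → Tight G b T (insert v S)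

variable {G T F : SimpleGraph V} {b : V → ℕ} {S : Set V}

/-- Both graphs have the same edges at `v`, so a comparison of components survives putting `v` back.
-/
theorem avoid_reachable_insert_mono {v : V}
    (hadj : ∀ c, F.Adj v c ↔ T.Adj v c)
    (h : ∀ a c, (avoid F (insert v S)).Reachable a c → (avoid T (insert v S)).Reachable a c)
    {a c : V} (hr : (avoid F S).Reachable a c) : (avoid T S).Reachable a c := by
  refine reachable_of_forall_adj ?_ hr
  intro p q hpq
  by_cases hp : p = v
  · subst hp
    exact Adj.reachable ⟨(hadj q).1 hpq.1, hpq.2⟩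
  by_cases hq : q = v
  · subst hq
    exact Adj.reachable ⟨((hadj p).1 hpq.1.symm).symm, hpq.2⟩
  · have h1 : (avoid F (insert v S)).Adj p q := ⟨hpq.1, by
      simp [hp, hpq.2.1], by simp [hq, hpq.2.2]⟩
    refine (h p q h1.reachable).mono ?_
    intro x y hxy
    exact ⟨hxy.1, fun hx => hxy.2.1 (Set.mem_insert_of_mem _ hx),
      fun hy => hxy.2.2 (Set.mem_insert_of_mem _ hy)⟩

theorem Equivalent.of_insert {v : V} (h : Equivalent G b T (insert v S) F) :
    Equivalent G b T S F where
  le := h.le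
  connected := h.connected
  degree_le := h.degree_le
  adj_iff a ha := h.adj_iff a (Set.mem_insert_of_mem _ ha)
  reachable_iff a c := by
    have hv := h.adj_iff v (Set.mem_insert _ _)
    exact ⟨avoid_reachable_insert_mono hv fun a c => (h.reachable_iff a c).1,
      avoid_reachable_insert_mono (fun c => (hv c).symm) fun a c => (h.reachable_iff a c).2⟩

theorem equivalent_self (hT : T ≤ G) (hc : T.Connected)
    (hd : ∀ v, (T.neighborSet v).ncard ≤ b v) (S : Set V) : Equivalent G b T S T :=
  ⟨hT, hc, hd, fun _ _ _ => Iff.rfl, fun _ _ => Iff.rfl⟩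

/-- Exchanging an edge `uv` for an edge `xy`. -/
theorem Equivalent.exchange [Finite V] (h : Equivalent G b T S F) {x y u w v : V} (hxy : G.Adj x y)
    (hx : x ∉ S) (hy : y ∉ S) (hdx : (F.neighborSet x).ncard < b x)
    (hdy : (F.neighborSet y).ncard < b y) (hxv : x ≠ v) (hyv : y ≠ v)
    (hxu : (avoid (avoid F S) {v}).Reachable x u) (huv : (avoid F S).Adj u v)
    (hyw : (avoid (avoid F S) {v}).Reachable y w) (hwv : (avoid F S).Adj w v) (huw : u ≠ w) :
    ∃ F', Equivalent G b T S F' ∧ (F'.neighborSet v).ncard < (F.neighborSet v).ncard := by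
  set F' : SimpleGraph V := (F ⊔ edge x y).deleteEdges {s(u, v)} with hF'
  have hadj : ∀ p q, F'.Adj p q ↔
      (F.Adj p q ∨ ((p = x ∧ q = y ∨ p = y ∧ q = x))) ∧
        ¬ (p = u ∧ q = v ∨ p = v ∧ q = u) := by
    intro p q
    have := hxy.ne
    simp only [hF', deleteEdges_adj, sup_adj, edge_adj, Set.mem_singleton_iff, Sym2.eq_iff]
    constructor
    · rintro ⟨h1, h2⟩
      exact ⟨h1.imp_right fun h => by tauto, h2⟩
    · rintro ⟨h1, h2⟩
      refine ⟨h1.imp_right fun h => ⟨by tauto, ?_⟩, h2⟩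
      rintro rfl
      rcases h with ⟨rfl, rfl⟩ | ⟨rfl, rfl⟩ <;> exact this rfl
  have hsub : avoid (avoid F S) {v} ≤ avoid F' S := by
    intro p q hpq
    have h1 : p ≠ v := hpq.2.1
    have h2 : q ≠ v := hpq.2.2
    exact ⟨(hadj p q).2 ⟨Or.inl hpq.1.1, by tauto⟩, hpq.1.2⟩
  have hxyF : (avoid F' S).Adj x y := ⟨(hadj x y).2 ⟨Or.inr (Or.inl ⟨rfl, rfl⟩), by tauto⟩, hx, hy⟩
  have hwvF : (avoid F' S).Adj w v :=
    ⟨(hadj w v).2 ⟨Or.inl hwv.1, by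
      have := hwv.1.ne
      have := huw.symm
      tauto⟩, hwv.2⟩
  -- The deleted edge is bypassed along $u,\dots,x,y,\dots,w,v$, entirely outside `S`, so no
  -- component splits.
  have huvF : (avoid F' S).Reachable u v :=
    ((((hxu.mono hsub).symm.trans hxyF.reachable).trans (hyw.mono hsub))).trans hwvF.reachable
  have hF_F' : ∀ p q, (avoid F S).Adj p q → (avoid F' S).Reachable p q := by
    intro p q hpq
    by_cases h1 : p = u ∧ q = v ∨ p = v ∧ q = u
    · rcases h1 with ⟨rfl, rfl⟩ | ⟨rfl, rfl⟩
      · exact huvF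
      · exact huvF.symm
    · exact Adj.reachable ⟨(hadj p q).2 ⟨Or.inl hpq.1, h1⟩, hpq.2⟩
  have hxyR : (avoid F S).Reachable x y :=
    (((hxu.mono (avoid_le _ _)).trans huv.reachable).trans hwv.symm.reachable).trans
      (hyw.mono (avoid_le _ _)).symm
  refine ⟨F', ⟨?_, ?_, ?_, ?_, ?_⟩, ?_⟩
  · intro p q hpq
    rcases ((hadj p q).1 hpq).1 with h1 | ⟨rfl, rfl⟩ | ⟨rfl, rfl⟩
    · exact h.le h1
    · exact hxy
    · exact hxy.symm
  · have := h.connected.nonempty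
    refine ⟨fun p q => ?_⟩
    refine reachable_of_forall_adj ?_ (h.connected.preconnected p q)
    intro p q hpq
    by_cases h1 : p = u ∧ q = v ∨ p = v ∧ q = u
    · have := huvF.mono (avoid_le F' S)
      rcases h1 with ⟨rfl, rfl⟩ | ⟨rfl, rfl⟩
      · exact this
      · exact this.symm
    · exact Adj.reachable ((hadj p q).2 ⟨Or.inl hpq, h1⟩)
  · intro p
    by_cases hpx : p = x
    · subst hpx
      have : F'.neighborSet p ⊆ insert y (F.neighborSet p) := by
        intro q hq
        have := hxy.ne
        rcases ((hadj p q).1 hq).1 with h1 | ⟨-, h1⟩ | ⟨h1, -⟩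
        · exact Or.inr h1
        · exact Or.inl h1
        · exact absurd h1 this
      have := (Set.ncard_le_ncard this (Set.toFinite _)).trans (Set.ncard_insert_le _ _)
      omega
    by_cases hpy : p = y
    · subst hpy
      have : F'.neighborSet p ⊆ insert x (F.neighborSet p) := by
        intro q hq
        rcases ((hadj p q).1 hq).1 with h1 | ⟨h1, -⟩ | ⟨-, h1⟩
        · exact Or.inr h1
        · exact absurd h1 hpx
        · exact Or.inl h1
      have := (Set.ncard_le_ncard this (Set.toFinite _)).trans (Set.ncard_insert_le _ _)
      omega
    · refine le_trans (Set.ncard_le_ncard ?_ (Set.toFinite _)) (h.degree_le p)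
      intro q hq
      rcases ((hadj p q).1 hq).1 with h1 | ⟨h1, -⟩ | ⟨h1, -⟩
      · exact h1
      · exact absurd h1 hpx
      · exact absurd h1 hpy
  · intro a ha c
    rw [← h.adj_iff a ha c, hadj]
    have h1 : a ≠ x := fun h => hx (h ▸ ha)
    have h2 : a ≠ y := fun h => hy (h ▸ ha)
    have h3 : a ≠ u := fun h => huv.2.1 (h ▸ ha)
    have h4 : a ≠ v := fun h => huv.2.2 (h ▸ ha)
    tauto
  · intro a c
    rw [← h.reachable_iff a c]
    refine ⟨reachable_of_forall_adj ?_, reachable_of_forall_adj hF_F'⟩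
    intro p q hpq
    rcases ((hadj p q).1 hpq.1).1 with h1 | ⟨rfl, rfl⟩ | ⟨rfl, rfl⟩
    · exact Adj.reachable ⟨h1, hpq.2⟩
    · exact hxyR
    · exact hxyR.symm
  · refine Set.ncard_lt_ncard ⟨?_, ?_⟩ (Set.toFinite _)
    · intro q hq
      rcases ((hadj v q).1 hq).1 with h1 | ⟨h1, -⟩ | ⟨h1, -⟩
      · exact h1
      · exact absurd h1.symm hxv
      · exact absurd h1.symm hyv
    · intro hss
      exact ((hadj v u).1 (hss huv.1.symm)).2 (Or.inr ⟨rfl, rfl⟩)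

/-- Induction on the order in which the set was built. If the last vertex `v` separates `x` from
`y`, both sides are attached to `v`. Adding $xy$ and dropping an edge at `v` gives a subgraph still
equivalent for the earlier set but with smaller degree at `v`, although that degree was forced. -/
theorem Tight.reachable [Finite V] (hS : Tight G b T S) (hF : Equivalent G b T S F) {x y : V}
    (hxy : G.Adj x y) (hx : x ∉ S) (hy : y ∉ S) (hdx : (F.neighborSet x).ncard < b x)
    (hdy : (F.neighborSet y).ncard < b y) : (avoid F S).Reachable x y := by
  induction hS with
  | empty =>
    rw [avoid_empty]
    exact hF.connected.preconnected x y
  | insert S v hS hv hdeg ih =>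
    simp only [Set.mem_insert_iff, not_or] at hx hy
    have hF' := hF.of_insert
    have hr := ih hF' hx.2 hy.2
    rw [avoid_insert]
    by_contra hn
    have hxv := (reachable_avoid_or v hr).resolve_left hn
    have hyv := (reachable_avoid_or v hr.symm).resolve_left fun h => hn h.symm
    obtain ⟨u, hxu, huv⟩ := exists_last_adj hx.1 hxv
    obtain ⟨w, hyw, hwv⟩ := exists_last_adj hy.1 hyv
    have huw : u ≠ w := by
      rintro rfl
      exact hn (hxu.trans hyw.symm)
    obtain ⟨F', hF'e, hlt⟩ := hF'.exchange hxy hx.2 hy.2 hdx hdy hx.1 hy.1 hxu huv hyw hwv huw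
    have h1 := hdeg _ hF'e
    have h2 := hdeg _ hF'
    omega

/-- Two equivalent subgraphs can be combined, one on a component and the other elsewhere. -/
theorem Equivalent.merge {F₁ F₂ : SimpleGraph V} (h₁ : Equivalent G b T S F₁)
    (h₂ : Equivalent G b T S F₂) {x y : V} (hx : x ∉ S)
    (hn : ¬ (avoid T S).Reachable x y) :
    ∃ F, Equivalent G b T S F ∧ F.neighborSet x = F₁.neighborSet x ∧
      F.neighborSet y = F₂.neighborSet y := by
  classical
  set C : Set V := {a | (avoid T S).Reachable x a} with hC
  have hCS : ∀ a ∈ C, a ∉ S := fun a ha => avoid_reachable_not_mem hx ha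
  have hcross : ∀ {F}, Equivalent G b T S F → ∀ a ∈ C, ∀ c ∉ C, F.Adj a c → c ∈ S := by
    intro F hF a ha c hc hac
    by_contra hcS
    refine hc (Reachable.trans ha ((hF.reachable_iff a c).1 ?_))
    exact Adj.reachable ⟨hac, hCS a ha, hcS⟩
  -- Edges leaving `C` end in `S`, where both subgraphs agree with `T`; this makes the gluing
  -- symmetric.
  have hswap : ∀ a ∈ C, ∀ c ∉ C, (F₁.Adj a c ↔ F₂.Adj a c) := by
    intro a ha c hc
    constructor
    · intro h
      have hcS := hcross h₁ a ha c hc h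
      exact ((h₂.adj_iff c hcS a).2 ((h₁.adj_iff c hcS a).1 h.symm)).symm
    · intro h
      have hcS := hcross h₂ a ha c hc h
      exact ((h₁.adj_iff c hcS a).2 ((h₂.adj_iff c hcS a).1 h.symm)).symm
  let F : SimpleGraph V :=
    { Adj := fun a c => if a ∈ C then F₁.Adj a c else F₂.Adj a c
      symm := ⟨by
        intro a c h
        by_cases ha : a ∈ C <;> by_cases hc : c ∈ C <;> simp only [ha, hc, if_true, if_false] at h ⊢
        · exact h.symm
        · exact ((hswap a ha c hc).1 h).symm
        · exact ((hswap c hc a ha).2 h.symm)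
        · exact h.symm⟩
      loopless := ⟨by
        intro a h
        by_cases ha : a ∈ C <;> simp only [ha, if_true, if_false] at h
        · exact F₁.irrefl h
        · exact F₂.irrefl h⟩ }
  have hF1 : ∀ a ∈ C, ∀ c, F.Adj a c ↔ F₁.Adj a c := fun a ha c => by simp [F, ha]
  have hF2 : ∀ a ∉ C, ∀ c, F.Adj a c ↔ F₂.Adj a c := fun a ha c => by simp [F, ha]
  have hFS : ∀ a ∈ S, ∀ c, F.Adj a c ↔ T.Adj a c := fun a ha c => by
    rw [hF2 a (fun h => hCS a h ha), h₂.adj_iff a ha]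
  have hreach1 : ∀ a c, (avoid F S).Adj a c → (avoid T S).Reachable a c := by
    intro a c hac
    by_cases ha : a ∈ C
    · exact (h₁.reachable_iff a c).1 (Adj.reachable ⟨(hF1 a ha c).1 hac.1, hac.2⟩)
    · exact (h₂.reachable_iff a c).1 (Adj.reachable ⟨(hF2 a ha c).1 hac.1, hac.2⟩)
  have hwalk1 : ∀ a c, (avoid F₁ S).Reachable a c → a ∈ C → (avoid F S).Reachable a c := by
    rintro a c ⟨p⟩ ha
    induction p with
    | nil => exact Reachable.rfl
    | @cons a d c hadj p ih =>
      have hd : d ∈ C := Reachable.trans ha ((h₁.reachable_iff a d).1 hadj.reachable)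
      exact (Adj.reachable (G := avoid F S) ⟨(hF1 a ha d).2 hadj.1, hadj.2⟩).trans (ih hd)
  have hwalk2 : ∀ a c, (avoid F₂ S).Reachable a c → a ∉ C → (avoid F S).Reachable a c := by
    rintro a c ⟨p⟩ ha
    induction p with
    | nil => exact Reachable.rfl
    | @cons a d c hadj p ih =>
      have hd : d ∉ C := fun hd =>
        ha (Reachable.trans hd ((h₂.reachable_iff d a).1 hadj.symm.reachable))
      exact (Adj.reachable (G := avoid F S) ⟨(hF2 a ha d).2 hadj.1, hadj.2⟩).trans (ih hd)
  have hreach2 : ∀ a c, (avoid T S).Reachable a c → (avoid F S).Reachable a c := by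
    intro a c hac
    by_cases ha : a ∈ C
    · exact hwalk1 a c ((h₁.reachable_iff a c).2 hac) ha
    · exact hwalk2 a c ((h₂.reachable_iff a c).2 hac) ha
  have hyC : y ∉ C := hn
  have hxC : x ∈ C := Reachable.rfl
  have hN1 : ∀ a ∈ C, F.neighborSet a = F₁.neighborSet a := fun a ha => by
    ext c
    exact hF1 a ha c
  have hN2 : ∀ a ∉ C, F.neighborSet a = F₂.neighborSet a := fun a ha => by
    ext c
    exact hF2 a ha c
  refine ⟨F, ⟨?_, ?_, ?_, hFS, ?_⟩, hN1 x hxC, hN2 y hyC⟩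
  · intro a c hac
    by_cases ha : a ∈ C
    · exact h₁.le ((hF1 a ha c).1 hac)
    · exact h₂.le ((hF2 a ha c).1 hac)
  · have := h₁.connected.nonempty
    refine ⟨fun a c => reachable_of_forall_adj ?_ (h₂.connected.preconnected a c)⟩
    intro p q hpq
    by_cases hp : p ∈ S
    · exact Adj.reachable ((hFS p hp q).2 ((h₂.adj_iff p hp q).1 hpq))
    by_cases hq : q ∈ S
    · exact (Adj.reachable ((hFS q hq p).2 ((h₂.adj_iff q hq p).1 hpq.symm))).symm
    · exact (hreach2 p q ((h₂.reachable_iff p q).1 (Adj.reachable ⟨hpq, hp, hq⟩))).mono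
        (avoid_le F S)
  · intro a
    by_cases ha : a ∈ C
    · rw [hN1 a ha]
      exact h₁.degree_le a
    · rw [hN2 a ha]
      exact h₂.degree_le a
  · exact fun a c => ⟨reachable_of_forall_adj hreach1, hreach2 a c⟩

theorem Tight.degree_eq (hS : Tight G b T S) (hT : T ≤ G) (hc : T.Connected)
    (hd : ∀ v, (T.neighborSet v).ncard ≤ b v) : ∀ v ∈ S, (T.neighborSet v).ncard = b v := by
  induction hS with
  | empty => exact fun v hv => absurd hv (Set.notMem_empty v)
  | insert S v hS hv hdeg ih =>
    rintro w (rfl | hw)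
    · exact hdeg T (equivalent_self hT hc hd S)
    · exact ih w hw

/-- A maximal tight set: the components of `T - S` are the components of `G - S`. -/
theorem exists_tight [Finite V] (hT : T ≤ G) (hc : T.Connected)
    (hd : ∀ v, (T.neighborSet v).ncard ≤ b v) {w : V}
    (hw : ∀ F, F ≤ G → F.Connected → (∀ v, (F.neighborSet v).ncard ≤ b v) →
      (F.neighborSet w).ncard = b w) :
    ∃ S : Set V, w ∈ S ∧ (∀ v ∈ S, (T.neighborSet v).ncard = b v) ∧
      ∀ x y, (avoid G S).Reachable x y → (avoid T S).Reachable x y := by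
  obtain ⟨S, hS⟩ := (Set.toFinite {S : Set V | Tight G b T S}).exists_maximal ⟨∅, Tight.empty⟩
  -- By maximality each vertex outside `S` has slack in some equivalent subgraph.
  have hout : ∀ v ∉ S, ∃ F, Equivalent G b T S F ∧ (F.neighborSet v).ncard < b v := by
    intro v hv
    by_contra! hcon
    have h1 : Tight G b T (insert v S) := Tight.insert S v hS.1 hv fun F hF =>
      le_antisymm (hF.degree_le v) (hcon F hF)
    exact hv (hS.2 h1 (Set.subset_insert _ _) (Set.mem_insert _ _))
  refine ⟨S, ?_, hS.1.degree_eq hT hc hd, fun x y => reachable_of_forall_adj ?_⟩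
  · by_contra hwS
    obtain ⟨F, hF, hlt⟩ := hout w hwS
    exact hlt.ne (hw F hF.le hF.connected hF.degree_le)
  · intro x y hxy
    by_contra hn
    -- The slack at `x` and at `y` may occur in different subgraphs. As the two vertices lie in
    -- different components of $T-S$, merging yields one subgraph with slack at both.
    obtain ⟨F₁, hF₁, h1⟩ := hout x hxy.2.1
    obtain ⟨F₂, hF₂, h2⟩ := hout y hxy.2.2
    obtain ⟨F, hF, hFx, hFy⟩ := hF₁.merge hF₂ hxy.2.1 hn
    rw [← hFx] at h1
    rw [← hFy] at h2
    exact hn ((hF.reachable_iff x y).1 (hS.1.reachable hF hxy.1 hxy.2.1 hxy.2.2 h1 h2))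

end Win

theorem ncard_neighborSet_eq_degree {V : Type*} (T : SimpleGraph V) (v : V) [Fintype (T.neighborSet v)] :
    (T.neighborSet v).ncard = T.degree v := by
  rw [← card_neighborSet_eq_degree, ← Nat.card_eq_fintype_card, Nat.card_coe_set_eq]

/-! ### Counting components, and Win's theorem. -/

section Count
variable {V : Type*} [Fintype V]

/-- A star on representatives of the components adds fewer edges than there are components and makes
the graph connected, so at least $|V|-1$ edges are then present. -/
theorem card_le_card_connectedComponent_add_card_edgeSet (H : SimpleGraph V) :
    Nat.card V ≤ Nat.card H.ConnectedComponent + Nat.card H.edgeSet := by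
  classical
  rcases isEmpty_or_nonempty V with hV | ⟨⟨v₀⟩⟩
  · simp
  set c₀ := H.connectedComponentMk v₀
  let r : H.ConnectedComponent → V := fun c => c.out
  have hr : ∀ c, H.connectedComponentMk (r c) = c := fun c => c.out_eq
  let E : Finset (Sym2 V) :=
    ((Finset.univ : Finset H.ConnectedComponent).erase c₀).image fun c => s(r c₀, r c)
  let H' : SimpleGraph V := H ⊔ fromEdgeSet (E : Set (Sym2 V))
  have hle : H ≤ H' := le_sup_left
  have hstar : ∀ c, H'.Reachable (r c₀) (r c) := by
    intro c
    by_cases hc : c = c₀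
    · rw [hc]
    · have hne : r c₀ ≠ r c := fun h => hc (by rw [← hr c, ← h, hr])
      refine Adj.reachable (Or.inr ?_)
      rw [fromEdgeSet_adj]
      exact ⟨by simpa [E] using ⟨c, hc, Or.inl rfl⟩, hne⟩
  have hto : ∀ v, H'.Reachable (r c₀) v := by
    intro v
    refine (hstar (H.connectedComponentMk v)).trans ?_
    exact (ConnectedComponent.exact (hr (H.connectedComponentMk v))).mono hle
  have hconn : H'.Connected := connected_iff_exists_forall_reachable _ |>.2 ⟨r c₀, hto⟩
  have h1 := hconn.card_vert_le_card_edgeSet_add_one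
  have h2 : H'.edgeSet ⊆ H.edgeSet ∪ (E : Set (Sym2 V)) := by
    intro e he
    simp only [H', edgeSet_sup, edgeSet_fromEdgeSet] at he
    exact he.imp_right fun h => h.1
  have h3 : Nat.card H'.edgeSet ≤ Nat.card H.edgeSet + E.card := by
    rw [Nat.card_coe_set_eq, Nat.card_coe_set_eq, ← Set.ncard_coe_finset]
    exact (Set.ncard_le_ncard h2 (Set.toFinite _)).trans (Set.ncard_union_le _ _)
  have h4 : E.card ≤ Fintype.card H.ConnectedComponent - 1 :=
    Finset.card_image_le.trans (by simp)
  have h5 : 0 < Fintype.card H.ConnectedComponent := Fintype.card_pos_iff.2 ⟨c₀⟩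
  rw [Nat.card_eq_fintype_card (α := H.ConnectedComponent)]
  omega

theorem card_edgeSet_lt_of_isAcyclic [Nonempty V] {H : SimpleGraph V} (hH : H.IsAcyclic) :
    Nat.card H.edgeSet < Nat.card V := by
  classical
  obtain ⟨T, hHT, -, hT⟩ := (connected_top (V := V)).exists_isTree_le_of_le_of_isAcyclic
    (le_top : H ≤ ⊤) hH
  have h1 := hT.card_edgeFinset
  have h2 : Nat.card H.edgeSet ≤ Nat.card T.edgeSet := by
    rw [Nat.card_coe_set_eq, Nat.card_coe_set_eq]
    exact Set.ncard_le_ncard (edgeSet_mono hHT) (Set.toFinite _)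
  have h3 : Nat.card T.edgeSet = T.edgeFinset.card := by
    rw [Nat.card_eq_fintype_card, ← edgeFinset_card]
  have h4 : Nat.card V = Fintype.card V := Nat.card_eq_fintype_card
  omega

/-- Deleting the vertices of `S` from a tree leaves many components; here the vertices of `S` are
kept as isolated vertices. -/
theorem sum_degree_add_two_le {T : SimpleGraph V} (hT : T.IsTree) {S : Finset V}
    (hS : S.Nonempty) :
    ∑ s ∈ S, (T.neighborSet s).ncard + 2 ≤
      Nat.card (avoid T (S : Set V)).ConnectedComponent + S.card := by
  classical
  have h1 := card_le_card_connectedComponent_add_card_edgeSet (avoid T (S : Set V))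
  have h2 := hT.card_edgeFinset
  have hdeg : ∀ s, (T.neighborSet s).ncard = (T.edgeFinset.filter fun e => s ∈ e).card := by
    intro s
    rw [← incidenceFinset_eq_filter, card_incidenceFinset_eq_degree, ncard_neighborSet_eq_degree]
  have hdc : ∑ s ∈ S, (T.edgeFinset.filter fun e => s ∈ e).card =
      ∑ e ∈ T.edgeFinset, (S.filter fun s => s ∈ e).card :=
    Finset.sum_card_bipartiteAbove_eq_sum_card_bipartiteBelow (fun s e => s ∈ e)
  -- In the degree sum an edge counts once for meeting `S` and once more for lying inside `S`. The
  -- edges inside form a forest on `S`, so there are at most $|S|-1$ of them.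
  have hedge : ∀ e ∈ T.edgeFinset, (S.filter fun s => s ∈ e).card ≤
      (if ∃ s ∈ S, s ∈ e then 1 else 0) + (if ∀ s ∈ e, s ∈ S then 1 else 0) := by
    intro e he
    induction e with | h a c =>
    by_cases ha : a ∈ S <;> by_cases hc : c ∈ S
    · have : (S.filter fun s => s ∈ s(a, c)) ⊆ {a, c} := by
        intro s hs
        simpa using (Finset.mem_filter.1 hs).2
      have h3 := (Finset.card_le_card this).trans Finset.card_le_two
      rw [if_pos ⟨a, ha, by simp⟩, if_pos (by simp [ha, hc])]
      exact h3
    · have : (S.filter fun s => s ∈ s(a, c)) ⊆ {a} := by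
        intro s hs
        rw [Finset.mem_filter, Sym2.mem_iff] at hs
        rcases hs.2 with h | h
        · simp [h]
        · exact absurd (h ▸ hs.1) hc
      have h3 := Finset.card_le_card this
      rw [if_pos ⟨a, ha, by simp⟩]
      simp only [Finset.card_singleton] at h3
      omega
    · have : (S.filter fun s => s ∈ s(a, c)) ⊆ {c} := by
        intro s hs
        rw [Finset.mem_filter, Sym2.mem_iff] at hs
        rcases hs.2 with h | h
        · exact absurd (h ▸ hs.1) ha
        · simp [h]
      have h3 := Finset.card_le_card this
      rw [if_pos ⟨c, hc, by simp⟩]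
      simp only [Finset.card_singleton] at h3
      omega
    · have : (S.filter fun s => s ∈ s(a, c)) = ∅ := by
        rw [Finset.filter_eq_empty_iff]
        intro s hs h
        rcases Sym2.mem_iff.1 h with h | h
        · exact ha (h ▸ hs)
        · exact hc (h ▸ hs)
      rw [this]
      simp
  have hsum := Finset.sum_le_sum hedge
  rw [Finset.sum_add_distrib, ← Finset.card_filter, ← Finset.card_filter] at hsum
  have hav : Nat.card (avoid T (S : Set V)).edgeSet =
      (T.edgeFinset.filter fun e => ¬ ∃ s ∈ S, s ∈ e).card := by
    rw [Nat.card_coe_set_eq, ← Set.ncard_coe_finset]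
    congr 1
    ext e
    induction e with | h a c =>
    simp only [mem_edgeSet, avoid_adj, Finset.coe_filter, Set.mem_ofPred_eq, mem_edgeFinset,
      Finset.mem_coe, Sym2.mem_iff]
    constructor
    · rintro ⟨h, ha, hc⟩
      refine ⟨h, ?_⟩
      rintro ⟨s, hs, rfl | rfl⟩
      · exact ha hs
      · exact hc hs
    · rintro ⟨h, h'⟩
      exact ⟨h, fun ha => h' ⟨a, ha, Or.inl rfl⟩, fun hc => h' ⟨c, hc, Or.inr rfl⟩⟩
  have hsplit := Finset.card_filter_add_card_filter_not (s := T.edgeFinset)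
    (fun e => ∃ s ∈ S, s ∈ e)
  have hin : (T.edgeFinset.filter fun e => ∀ s ∈ e, s ∈ S).card < S.card := by
    have : Nonempty (S : Set V) := hS.to_subtype
    have h3 := card_edgeSet_lt_of_isAcyclic (hT.isAcyclic.induce (S : Set V))
    have h4 : (T.edgeFinset.filter fun e => ∀ s ∈ e, s ∈ S).card ≤
        Nat.card (T.induce (S : Set V)).edgeSet := by
      rw [Nat.card_coe_set_eq, ← Set.ncard_coe_finset]
      refine le_trans (Set.ncard_le_ncard ?_ (Set.toFinite _))
        (Set.ncard_image_le (f := Sym2.map Subtype.val) (Set.toFinite _))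
      intro e
      induction e with | h a c =>
      intro he
      simp only [Finset.coe_filter, Set.mem_ofPred_eq, mem_edgeFinset, mem_edgeSet] at he
      have ha := he.2 a (by simp)
      have hc := he.2 c (by simp)
      exact ⟨s(⟨a, ha⟩, ⟨c, hc⟩), he.1, rfl⟩
    have h5 : Nat.card (S : Set V) = S.card := by simp
    omega
  have h4 : Nat.card V = Fintype.card V := Nat.card_eq_fintype_card
  simp only [hdeg]
  rw [hdc]
  omega

/-- Win's theorem on spanning `k`-trees. -/
theorem exists_card_connectedComponent_of_not_hasSpanningKTree {G : SimpleGraph V} {k : ℕ}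
    (hG : G.Connected) (hk : ¬ HasSpanningKTree k G) :
    ∃ S : Finset V, S.Nonempty ∧
      k * S.card + 3 ≤ Nat.card (avoid G (S : Set V)).ConnectedComponent + S.card := by
  classical
  -- Truncated subtraction: only degrees above `k` contribute.
  let excess : SimpleGraph V → ℕ := fun T => ∑ v, ((T.neighborSet v).ncard - k)
  obtain ⟨T, ⟨hTG, hT⟩, hmin⟩ := (Set.toFinite {T : SimpleGraph V | T ≤ G ∧ T.IsTree}).exists_minimalFor
    excess _ (by obtain ⟨T, h⟩ := hG.exists_isTree_le; exact ⟨T, h⟩)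
  have hw : ∃ w, k < (T.neighborSet w).ncard := by
    by_contra! hcon
    refine hk ⟨T, hTG, hT, fun v => ?_⟩
    rw [← ncard_neighborSet_eq_degree]
    exact hcon v
  obtain ⟨w, hw⟩ := hw
  -- Within this bound no vertex exceeds its excess in `T`, so a connected subgraph with smaller
  -- degree at `w` would contain a tree of smaller excess. The degree at `w` is therefore forced.
  let b : V → ℕ := fun v => max k (T.neighborSet v).ncard
  obtain ⟨S, hwS, hSdeg, hreach⟩ := exists_tight (b := b) hTG hT.connected
    (fun v => le_max_right _ _) (w := w) (by
      intro F hFG hF hd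
      refine le_antisymm (hd w) ?_
      obtain ⟨T', hT'F, hT'⟩ := hF.exists_isTree_le
      have hle : ∀ v, (T'.neighborSet v).ncard ≤ (F.neighborSet v).ncard := fun v =>
        Set.ncard_le_ncard (fun x hx => hT'F hx) (Set.toFinite _)
      have hterm : ∀ v, (T'.neighborSet v).ncard - k ≤ (T.neighborSet v).ncard - k := by
        intro v
        have h1 := (hle v).trans (hd v)
        simp only [b] at h1
        omega
      by_contra! hlt
      have hlt' : excess T' < excess T := by
        refine Finset.sum_lt_sum (fun v _ => hterm v) ⟨w, Finset.mem_univ _, ?_⟩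
        have := hle w
        simp only [b] at hlt
        omega
      exact absurd (hmin ⟨hT'F.trans hFG, hT'⟩ hlt'.le) (not_le.2 hlt'))
  have hSne : S.toFinset.Nonempty := ⟨w, by simpa using hwS⟩
  refine ⟨S.toFinset, hSne, ?_⟩
  have h1 := sum_degree_add_two_le hT hSne
  rw [Set.coe_toFinset] at h1 ⊢
  have h2 : k * S.toFinset.card + 1 ≤ ∑ s ∈ S.toFinset, (T.neighborSet s).ncard := by
    have : ∑ s ∈ S.toFinset, k < ∑ s ∈ S.toFinset, (T.neighborSet s).ncard := by
      refine Finset.sum_lt_sum (fun s hs => ?_) ⟨w, by simpa using hwS, hw⟩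
      rw [hSdeg s (by simpa using hs)]
      exact le_max_left _ _
    rw [Finset.sum_const, smul_eq_mul, mul_comm] at this
    exact this
  have h3 : Nat.card (avoid T S).ConnectedComponent ≤ Nat.card (avoid G S).ConnectedComponent := by
    refine Nat.card_le_card_of_surjective
      (ConnectedComponent.lift (fun v => (avoid T S).connectedComponentMk v) ?_) ?_
    · intro v w p _
      exact ConnectedComponent.sound (hreach v w p.reachable)
    · intro c
      obtain ⟨v, rfl⟩ := c.exists_rep
      exact ⟨(avoid G S).connectedComponentMk v, rfl⟩
  omega

end Count

/-! ### Eigenvalue bounds from positive supersolutions. -/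

section Spectral
variable {V : Type*} [Fintype V]

open Classical in
/-- The adjacency operator of `G` applied to the vector `x`. -/
noncomputable def adjSum (G : SimpleGraph V) (x : V → ℝ) (v : V) : ℝ :=
  ∑ w, if G.Adj v w then x w else 0

theorem toLin'_adjMatrix_apply (G : SimpleGraph V) [DecidableEq V] [DecidableRel G.Adj]
    (x : V → ℝ) (v : V) : Matrix.toLin' (G.adjMatrix ℝ) x v = adjSum G x v := by
  rw [Matrix.toLin'_apply, Matrix.mulVec, dotProduct, adjSum]
  refine Finset.sum_congr rfl fun w _ => ?_
  by_cases h : G.Adj v w <;> simp [h, adjMatrix_apply]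

theorem mem_adjEigenvalues_iff {G : SimpleGraph V} {μ : ℝ} :
    μ ∈ adjEigenvalues G ↔ ∃ x : V → ℝ, x ≠ 0 ∧ ∀ v, adjSum G x v = μ * x v := by
  classical
  change Module.End.HasEigenvalue _ _ ↔ _
  constructor
  · intro h
    obtain ⟨x, hx⟩ := h.exists_hasEigenvector
    refine ⟨x, hx.2, fun v => ?_⟩
    rw [← toLin'_adjMatrix_apply G x v]
    have := congrFun hx.apply_eq_smul v
    simpa using this
  · rintro ⟨x, hx, h⟩
    refine Module.End.hasEigenvalue_of_hasEigenvector (x := x) ⟨?_, hx⟩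
    rw [Module.End.mem_eigenspace_iff]
    ext v
    rw [toLin'_adjMatrix_apply, h]
    simp

theorem sum_mul_adjSum_comm (G : SimpleGraph V) (x y : V → ℝ) :
    ∑ v, x v * adjSum G y v = ∑ v, y v * adjSum G x v := by
  classical
  simp only [adjSum, Finset.mul_sum]
  rw [Finset.sum_comm]
  refine Finset.sum_congr rfl fun v _ => Finset.sum_congr rfl fun w _ => ?_
  by_cases h : G.Adj v w
  · simp [h, h.symm, mul_comm]
  · have h' : ¬ G.Adj w v := fun h' => h h'.symm
    simp [h, h']

theorem adjSum_mono {G H : SimpleGraph V} (h : G ≤ H) {x : V → ℝ} (hx : ∀ v, 0 ≤ x v) (v : V) :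
    adjSum G x v ≤ adjSum H x v := by
  classical
  refine Finset.sum_le_sum fun w _ => ?_
  by_cases hg : G.Adj v w
  · simp [hg, h hg]
  · by_cases hh : H.Adj v w <;> simp [hg, hh, hx]

theorem mul_abs_le_adjSum_abs {G : SimpleGraph V} {μ : ℝ} {y : V → ℝ}
    (hy : ∀ v, adjSum G y v = μ * y v) (v : V) :
    μ * |y v| ≤ adjSum G (fun w => |y w|) v := by
  classical
  calc μ * |y v| ≤ |μ| * |y v| := by gcongr; exact le_abs_self μ
    _ = |adjSum G y v| := by rw [hy, abs_mul]
    _ ≤ ∑ w, |if G.Adj v w then y w else 0| := Finset.abs_sum_le_sum_abs _ _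
    _ = adjSum G (fun w => |y w|) v := by
      refine Finset.sum_congr rfl fun w _ => ?_
      by_cases h : G.Adj v w <;> simp [h]

variable {G M : SimpleGraph V} {x : V → ℝ} {t μ : ℝ}

/-- Pairing `x` with $|y|$ and using symmetry of the adjacency operator chains the three
inequalities. When $\mu=t$ all of them are equalities, which drives the equality case. -/
theorem le_and_le_of_mem_adjEigenvalues (hGM : G ≤ M) (hx : ∀ v, 0 < x v)
    (hM : ∀ v, adjSum M x v ≤ t * x v) {y : V → ℝ} (hy : ∀ v, adjSum G y v = μ * y v) :
    μ * ∑ v, x v * |y v| ≤ ∑ v, x v * adjSum G (fun w => |y w|) v ∧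
      ∑ v, |y v| * adjSum M x v ≤ t * ∑ v, x v * |y v| ∧
      ∑ v, x v * adjSum G (fun w => |y w|) v ≤ ∑ v, |y v| * adjSum M x v := by
  refine ⟨?_, ?_, ?_⟩
  · rw [Finset.mul_sum]
    refine Finset.sum_le_sum fun v _ => ?_
    have := mul_le_mul_of_nonneg_left (mul_abs_le_adjSum_abs hy v) (hx v).le
    linarith
  · rw [Finset.mul_sum]
    refine Finset.sum_le_sum fun v _ => ?_
    have := mul_le_mul_of_nonneg_left (hM v) (abs_nonneg (y v))
    linarith
  · rw [sum_mul_adjSum_comm]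
    exact Finset.sum_le_sum fun v _ =>
      mul_le_mul_of_nonneg_left (adjSum_mono hGM (fun w => (hx w).le) v) (abs_nonneg (y v))

theorem sum_mul_abs_pos (hx : ∀ v, 0 < x v) {y : V → ℝ} (hy : y ≠ 0) :
    0 < ∑ v, x v * |y v| := by
  obtain ⟨v, hv⟩ := Function.ne_iff.1 hy
  exact Finset.sum_pos' (fun w _ => mul_nonneg (hx w).le (abs_nonneg _))
    ⟨v, Finset.mem_univ _, mul_pos (hx v) (abs_pos.2 hv)⟩

/-- A positive supersolution for a supergraph bounds the eigenvalues. -/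
theorem eigenvalue_le_of_supersolution (hGM : G ≤ M) (hx : ∀ v, 0 < x v)
    (hM : ∀ v, adjSum M x v ≤ t * x v) (hμ : μ ∈ adjEigenvalues G) : μ ≤ t := by
  obtain ⟨y, hy0, hy⟩ := mem_adjEigenvalues_iff.1 hμ
  obtain ⟨h1, h2, h3⟩ := le_and_le_of_mem_adjEigenvalues hGM hx hM hy
  exact le_of_mul_le_mul_right (h1.trans (h3.trans h2)) (sum_mul_abs_pos hx hy0)

/-- The equality case of `eigenvalue_le_of_supersolution` for a connected graph. -/
theorem eq_of_supersolution (hG : G.Connected) (hGM : G ≤ M) (hx : ∀ v, 0 < x v)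
    (hM : ∀ v, adjSum M x v ≤ t * x v) (hμ : μ ∈ adjEigenvalues G) (hle : t ≤ μ) :
    G = M ∧ ∀ v, adjSum M x v = t * x v := by
  classical
  have heq : μ = t := le_antisymm (eigenvalue_le_of_supersolution hGM hx hM hμ) hle
  subst heq
  obtain ⟨y, hy0, hy⟩ := mem_adjEigenvalues_iff.1 hμ
  obtain ⟨h1, h2, h3⟩ := le_and_le_of_mem_adjEigenvalues hGM hx hM hy
  have hz : ∀ v, μ * |y v| = adjSum G (fun w => |y w|) v := by
    have h4 : ∑ v, x v * (μ * |y v|) = ∑ v, x v * adjSum G (fun w => |y w|) v := by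
      refine Eq.trans ?_ (le_antisymm h1 (h3.trans h2))
      rw [Finset.mul_sum]
      exact Finset.sum_congr rfl fun v _ => by ring
    have h5 := (Finset.sum_eq_sum_iff_of_le fun v _ =>
      mul_le_mul_of_nonneg_left (mul_abs_le_adjSum_abs hy v) (hx v).le).1 h4
    exact fun v => mul_left_cancel₀ (hx v).ne' (h5 v (Finset.mem_univ _))
  -- As in Perron–Frobenius: $|y|$ is a nonnegative eigenvector, so a zero spreads to all neighbours
  -- and, by connectedness, everywhere.
  have hstep : ∀ v w, G.Adj v w → y v = 0 → y w = 0 := by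
    intro v w hvw hv
    have h4 := hz v
    rw [hv, abs_zero, mul_zero, adjSum] at h4
    have h5 := (Finset.sum_eq_zero_iff_of_nonneg fun w _ => by
      split_ifs <;> simp).1 h4.symm w (Finset.mem_univ _)
    simpa [hvw] using h5
  have hpos : ∀ v, 0 < |y v| := by
    intro v
    rw [abs_pos]
    intro hv
    refine hy0 (funext fun w => ?_)
    obtain ⟨p⟩ := hG.preconnected v w
    induction p with
    | nil => exact hv
    | cons hadj _ ih => exact ih (hstep _ _ hadj hv)
  have hMx : ∀ v, adjSum M x v = μ * x v := by
    have h4 : ∑ v, |y v| * adjSum M x v = ∑ v, |y v| * (μ * x v) := by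
      refine (le_antisymm h2 (h1.trans h3)).trans ?_
      rw [Finset.mul_sum]
      exact Finset.sum_congr rfl fun v _ => by ring
    have h5 := (Finset.sum_eq_sum_iff_of_le fun v _ =>
      mul_le_mul_of_nonneg_left (hM v) (abs_nonneg (y v))).1 h4
    exact fun v => mul_left_cancel₀ (hpos v).ne' (h5 v (Finset.mem_univ _))
  have hGx : ∀ v, adjSum G x v = adjSum M x v := by
    have h4 : ∑ v, |y v| * adjSum G x v = ∑ v, |y v| * adjSum M x v := by
      rw [← sum_mul_adjSum_comm]
      exact le_antisymm h3 (h2.trans h1)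
    have h5 := (Finset.sum_eq_sum_iff_of_le fun v _ =>
      mul_le_mul_of_nonneg_left (adjSum_mono hGM (fun w => (hx w).le) v) (abs_nonneg (y v))).1 h4
    exact fun v => mul_left_cancel₀ (hpos v).ne' (h5 v (Finset.mem_univ _))
  refine ⟨le_antisymm hGM fun v w hvw => ?_, hMx⟩
  by_contra hn
  refine (hGx v).not_lt (Finset.sum_lt_sum (fun u _ => ?_) ⟨w, Finset.mem_univ _, ?_⟩)
  · by_cases hg : G.Adj v u
    · simp [hg, hGM hg]
    · by_cases hh : M.Adj v u <;> simp [hg, hh, (hx u).le]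
  · simp [hn, hvw, hx]

end Spectral

/-! ### Joins of a clique with disjoint cliques. -/

section Clusters
variable {V C : Type*}

/-- The graph in which the vertices of colour `none` are adjacent to all others, and the remaining
vertices are adjacent when they have the same colour. -/
def clusterJoin (f : V → Option C) : SimpleGraph V where
  Adj a b := a ≠ b ∧ (f a = none ∨ f b = none ∨ f a = f b)
  symm := ⟨fun _ _ h => ⟨h.1.symm, by
    rcases h.2 with h | h | h
    · exact Or.inr (Or.inl h)
    · exact Or.inl h
    · exact Or.inr (Or.inr h.symm)⟩⟩
  loopless := ⟨fun _ h => h.1 rfl⟩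

theorem clusterJoin_adj {f : V → Option C} {a b : V} :
    (clusterJoin f).Adj a b ↔ a ≠ b ∧ (f a = none ∨ f b = none ∨ f a = f b) := Iff.rfl

variable [Fintype V]

open Classical in
/-- The number of vertices with a given colour. -/
noncomputable def classCard (f : V → Option C) (o : Option C) : ℕ :=
  (Finset.univ.filter fun v => f v = o).card

/-- The test vector on a `clusterJoin`, constant on the colour classes. -/
noncomputable def clusterVector (f : V → Option C) (L : ℝ) : Option C → ℝ
  | none => 1
  | some c => classCard f none / (L - classCard f (some c))

theorem clusterVector_pos {f : V → Option C} {L : ℝ} (h0 : 0 < classCard f none)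
    (hL : ∀ c, (classCard f (some c) : ℝ) < L) (o : Option C) : 0 < clusterVector f L o := by
  cases o with
  | none => exact one_pos
  | some c => exact div_pos (by exact_mod_cast h0) (by linarith [hL c])

variable [Fintype C]

theorem sum_comp_eq_sum_classCard (f : V → Option C) (φ : Option C → ℝ) :
    ∑ v, φ (f v) = classCard f none * φ none + ∑ c, classCard f (some c) * φ (some c) := by
  classical
  rw [← Fintype.sum_option fun o => (classCard f o : ℝ) * φ o, ← Finset.sum_fiberwise' _ f φ]
  refine Finset.sum_congr rfl fun o _ => ?_
  rw [Finset.sum_const, nsmul_eq_mul, classCard]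

theorem card_eq_sum_classCard (f : V → Option C) :
    Fintype.card V = classCard f none + ∑ c, classCard f (some c) := by
  have := sum_comp_eq_sum_classCard f fun _ => 1
  simp only [Finset.sum_const, Finset.card_univ, nsmul_eq_mul, mul_one] at this
  exact_mod_cast this

theorem adjSum_clusterJoin (f : V → Option C) (φ : Option C → ℝ) (v : V) :
    adjSum (clusterJoin f) (fun w => φ (f w)) v =
      (match f v with
        | none => ∑ w, φ (f w)
        | some c => classCard f none * φ none + classCard f (some c) * φ (some c)) - φ (f v) := by
  classical
  have h1 : adjSum (clusterJoin f) (fun w => φ (f w)) v =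
      (∑ w, if f v = none ∨ f w = none ∨ f v = f w then φ (f w) else 0) - φ (f v) := by
    rw [eq_sub_iff_add_eq, adjSum, ← Finset.sum_erase_add _ _ (Finset.mem_univ v)]
    conv_rhs => rw [← Finset.sum_erase_add _ _ (Finset.mem_univ v)]
    simp only [or_true, if_true, SimpleGraph.irrefl, if_false, add_zero]
    congr 1
    refine Finset.sum_congr rfl fun w hw => ?_
    have : v ≠ w := (Finset.ne_of_mem_erase hw).symm
    simp only [clusterJoin_adj, this, ne_eq, not_false_eq_true, true_and]
  rw [h1]
  congr 1
  cases hv : f v with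
  | none => simp
  | some c =>
    have := sum_comp_eq_sum_classCard f fun o => if o = none ∨ some c = o then φ o else 0
    simp only [reduceCtorEq, false_or]
    rw [this]
    simp [Finset.sum_ite_eq]

/-- With $s$ full vertices and class size $a$, the entry $x=s/(L-a)$ is the solution of
$s+(a-1)x=(L-1)x$. -/
theorem adjSum_clusterVector_some {f : V → Option C} {L : ℝ} {v : V} {c : C} (hv : f v = some c)
    (hL : (classCard f (some c) : ℝ) < L) :
    adjSum (clusterJoin f) (fun w => clusterVector f L (f w)) v =
      (L - 1) * clusterVector f L (f v) := by
  rw [adjSum_clusterJoin, hv]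
  have : L - classCard f (some c) ≠ 0 := by linarith
  simp only [clusterVector]
  field_simp
  ring

theorem adjSum_clusterVector_none {f : V → Option C} {L : ℝ} {v : V} (hv : f v = none) :
    adjSum (clusterJoin f) (fun w => clusterVector f L (f w)) v =
      classCard f none - 1 +
        classCard f none * ∑ c, (classCard f (some c) : ℝ) / (L - classCard f (some c)) := by
  rw [adjSum_clusterJoin, hv]
  simp only [sum_comp_eq_sum_classCard f (clusterVector f L)]
  simp only [clusterVector, Finset.mul_sum]
  rw [add_sub_right_comm, mul_one]
  congr 1
  exact Finset.sum_congr rfl fun c _ => by ring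

/-- Cluster joins with the same numbers of classes of each size are isomorphic. -/
theorem nonempty_iso_clusterJoin {V' C' : Type*} [Fintype V'] [Fintype C'] {f : V → Option C}
    {g : V' → Option C'} (h0 : classCard f none = classCard g none)
    (h : ∀ t : ℕ, Nat.card {c // classCard f (some c) = t} =
      Nat.card {c // classCard g (some c) = t}) :
    Nonempty (clusterJoin f ≃g clusterJoin g) := by
  classical
  have e1 : ∀ t : ℕ, {c // classCard f (some c) = t} ≃ {c // classCard g (some c) = t} :=
    fun t => Fintype.equivOfCardEq (by
      simpa only [Nat.card_eq_fintype_card] using h t)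
  let σ : C ≃ C' := Equiv.ofFiberEquiv e1
  have hσ : ∀ c, classCard g (some (σ c)) = classCard f (some c) := fun c =>
    Equiv.ofFiberEquiv_map e1 c
  have hfib : ∀ o : Option C, Fintype.card {v // f v = o} =
      Fintype.card {v // (g v).map σ.symm = o} := by
    intro o
    rw [Fintype.card_subtype, Fintype.card_subtype]
    cases o with
    | none => simpa [classCard] using h0
    | some c =>
      have := (hσ c).symm
      simpa [classCard, Equiv.symm_apply_eq] using this
  have e2 : ∀ o : Option C, {v // f v = o} ≃ {v // (g v).map σ.symm = o} :=
    fun o => Fintype.equivOfCardEq (hfib o)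
  let e : V ≃ V' := Equiv.ofFiberEquiv e2
  have he : ∀ v, (g (e v)).map σ.symm = f v := fun v => Equiv.ofFiberEquiv_map e2 v
  refine ⟨⟨e, ?_⟩⟩
  intro a b
  rw [clusterJoin_adj, clusterJoin_adj, ← he a, ← he b]
  simp only [ne_eq, EmbeddingLike.apply_eq_iff_eq, Option.map_eq_none_iff]
  rw [(Option.map_injective σ.symm.injective).eq_iff]

end Clusters

/-! ### Extremal class sizes by convexity. -/

section Sizes
variable {C : Type*} [Fintype C] {a : C → ℕ} {i m : ℕ} {L : ℝ}

-- Apart from any given class there are at least $i+2$ classes, two of them of size at least $2$,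
-- which together use at least $i+4$ vertices.
open Classical in
theorem size_le_of_card_le (ha : ∀ c, 1 ≤ a c) (hC : i + 3 ≤ Fintype.card C)
    (h1 : (Finset.univ.filter fun c => a c = 1).card ≤ i) (hsum : ∑ c, a c = m + 4 + i) :
    2 ≤ m ∧ ∀ c, a c ≤ m := by
  have hsplit := Finset.card_filter_add_card_filter_not (s := (Finset.univ : Finset C))
    (fun c => a c = 1)
  rw [Finset.card_univ] at hsplit
  have hle : ∀ c, a c ≤ m := by
    intro c
    have h2 := Finset.sum_erase_add Finset.univ a (Finset.mem_univ c)
    have h3 : ∑ d ∈ Finset.univ.erase c, (1 + if ¬ a d = 1 then 1 else 0) ≤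
        ∑ d ∈ Finset.univ.erase c, a d := by
      refine Finset.sum_le_sum fun d _ => ?_
      have := ha d
      split_ifs <;> omega
    rw [Finset.sum_add_distrib, Finset.sum_const, smul_eq_mul, mul_one,
      Finset.card_erase_of_mem (Finset.mem_univ c), Finset.card_univ, ← Finset.card_filter,
      Finset.filter_erase] at h3
    have h4 := Finset.pred_card_le_card_erase (s := Finset.univ.filter fun d => ¬ a d = 1) (a := c)
    omega
  refine ⟨?_, hle⟩
  obtain ⟨c, hc⟩ : (Finset.univ.filter fun c => ¬ a c = 1).Nonempty := by
    rw [← Finset.card_pos]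
    omega
  have h2 := (Finset.mem_filter.1 hc).2
  have h3 := ha c
  have h4 := hle c
  omega

/-- The slope of the chord of `t ↦ t / (L - t)` between `2` and `m`. -/
noncomputable def chordSlope (L m : ℝ) : ℝ := L / ((L - m) * (L - 2))

theorem chord_sub {t m : ℝ} (ht : t < L) (hm : m < L) (h2 : 2 < L) :
    2 / (L - 2) + chordSlope L m * (t - 2) - t / (L - t) =
      L * (t - 2) * (m - t) / ((L - m) * (L - 2) * (L - t)) := by
  have h1 : L - t ≠ 0 := by linarith
  have h3 : L - m ≠ 0 := by linarith
  have h4 : L - 2 ≠ 0 := by linarith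
  rw [chordSlope]
  field_simp
  ring

-- Every class is compared with the chord through $2$ and $m$. The chord is negative at $0$, so
-- surplus classes lower the sum. The function exceeds the chord at $1$, so unused singletons lower
-- it as well. The remaining gap is that of convexity, with the `if` cancelling the term at size
-- $1$.
open Classical in
theorem sum_size_div_sub (hm : (m : ℝ) < L) (h2 : 2 < L) (hle : ∀ c, a c ≤ m)
    (hsum : ∑ c, a c = m + 4 + i) :
    (m / (L - m) + 2 * (2 / (L - 2)) + i * (1 / (L - 1)) : ℝ) - ∑ c, (a c : ℝ) / (L - a c) =
      ((Fintype.card C : ℝ) - (i + 3)) * (2 * chordSlope L m - 2 / (L - 2)) +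
      (i - (Finset.univ.filter fun c => a c = 1).card : ℝ) *
        (L * (m - 1) / ((L - m) * (L - 2) * (L - 1))) +
      ∑ c, (L * (a c - 2) * (m - a c) / ((L - m) * (L - 2) * (L - a c)) +
        if a c = 1 then L * (m - 1) / ((L - m) * (L - 2) * (L - 1)) else 0) := by
  have hmL := chord_sub (t := m) hm hm h2
  have h1L := chord_sub (t := 1) (by linarith) hm h2
  have hc : ∀ c, L * ((a c : ℝ) - 2) * (m - a c) / ((L - m) * (L - 2) * (L - a c)) =
      2 / (L - 2) + chordSlope L m * (a c - 2) - a c / (L - a c) := fun c =>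
    (chord_sub (lt_of_le_of_lt (by exact_mod_cast hle c) hm) hm h2).symm
  simp only [hc, Finset.sum_add_distrib, Finset.sum_sub_distrib, ← Finset.mul_sum]
  rw [← Finset.sum_filter]
  simp only [Finset.sum_const, Finset.card_univ, nsmul_eq_mul]
  have hs : ∑ c, (a c : ℝ) = m + 4 + i := by exact_mod_cast hsum
  rw [hs]
  have e1 : (m : ℝ) / (L - m) = 2 / (L - 2) + chordSlope L m * (m - 2) := by
    rw [sub_self, mul_zero, zero_div] at hmL
    linarith
  have e2 : (1 : ℝ) / (L - 1) = 2 / (L - 2) - chordSlope L m +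
      L * (m - 1) / ((L - m) * (L - 2) * (L - 1)) := by
    have : L * ((1 : ℝ) - 2) * (m - 1) / ((L - m) * (L - 2) * (L - 1)) =
      - (L * (m - 1) / ((L - m) * (L - 2) * (L - 1))) := by ring
    rw [this] at h1L
    linarith
  rw [e1, e2]
  ring

theorem chord_intercept_pos {m : ℝ} (hm0 : 0 < m) (hm : m < L) (h2 : 2 < L) :
    0 < 2 * chordSlope L m - 2 / (L - 2) := by
  have h3 : L - m ≠ 0 := by linarith
  have h4 : L - 2 ≠ 0 := by linarith
  have : 2 * chordSlope L m - 2 / (L - 2) = 2 * m / ((L - m) * (L - 2)) := by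
    rw [chordSlope]
    field_simp
    ring
  rw [this]
  exact div_pos (by linarith) (mul_pos (by linarith) (by linarith))

theorem chord_term_nonneg (hm : (m : ℝ) < L) (h2 : 2 < L) {t : ℕ} (ht1 : 1 ≤ t) (ht : t ≤ m) :
    (0 : ℝ) ≤ L * (t - 2) * (m - t) / ((L - m) * (L - 2) * (L - t)) +
      if t = 1 then L * (m - 1) / ((L - m) * (L - 2) * (L - 1)) else 0 := by
  have htm : (t : ℝ) ≤ m := by exact_mod_cast ht
  split_ifs with h
  · subst h
    have : L * ((1 : ℕ) - 2) * (m - (1 : ℕ)) / ((L - m) * (L - 2) * (L - (1 : ℕ))) +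
      L * (m - 1) / ((L - m) * (L - 2) * (L - 1)) = 0 := by
      push_cast
      ring
    exact this.ge
  · have h3 : (2 : ℝ) ≤ t := by exact_mod_cast (by omega : 2 ≤ t)
    rw [add_zero]
    exact div_nonneg (mul_nonneg (mul_nonneg (by linarith) (by linarith)) (by linarith))
      (mul_nonneg (mul_nonneg (by linarith) (by linarith)) (by linarith))

theorem chord_delta_pos {m : ℝ} (hm1 : 1 < m) (hm : m < L) (h2 : 2 < L) :
    0 < L * (m - 1) / ((L - m) * (L - 2) * (L - 1)) :=
  div_pos (mul_pos (by linarith) (by linarith))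
    (mul_pos (mul_pos (by linarith) (by linarith)) (by linarith))

open Classical in
/-- Among the possible component sizes, one large part, two parts of size two and `i` singletons
maximize the convex sum. -/
theorem sum_size_div_le (ha : ∀ c, 1 ≤ a c) (hC : i + 3 ≤ Fintype.card C)
    (h1 : (Finset.univ.filter fun c => a c = 1).card ≤ i) (hsum : ∑ c, a c = m + 4 + i)
    (hm : (m : ℝ) < L) (h2 : 2 < L) :
    ∑ c, (a c : ℝ) / (L - a c) ≤ m / (L - m) + 2 * (2 / (L - 2)) + i * (1 / (L - 1)) := by
  obtain ⟨hm2, hle⟩ := size_le_of_card_le ha hC h1 hsum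
  have hmR : (2 : ℝ) ≤ m := by exact_mod_cast hm2
  rw [← sub_nonneg, sum_size_div_sub hm h2 hle hsum]
  refine add_nonneg (add_nonneg (mul_nonneg ?_ ?_) (mul_nonneg ?_ ?_)) (Finset.sum_nonneg ?_)
  · rw [sub_nonneg]
    exact_mod_cast hC
  · exact (chord_intercept_pos (by linarith) hm h2).le
  · rw [sub_nonneg]
    exact_mod_cast h1
  · exact (chord_delta_pos (by linarith) hm h2).le
  · exact fun c _ => chord_term_nonneg hm h2 (ha c) (hle c)

-- Equality kills all three nonnegative parts of the gap: there are $i+3$ classes, $i$ singletons,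
-- and all others have size $2$ or $m$. The number of classes and the total size then fix the
-- multiplicities, since $m\ne2$.
open Classical in
theorem card_size_of_sum_eq (ha : ∀ c, 1 ≤ a c) (hC : i + 3 ≤ Fintype.card C)
    (h1 : (Finset.univ.filter fun c => a c = 1).card ≤ i) (hsum : ∑ c, a c = m + 4 + i)
    (hm : (m : ℝ) < L) (h2 : 2 < L) (hm3 : 3 ≤ m)
    (heq : ∑ c, (a c : ℝ) / (L - a c) = m / (L - m) + 2 * (2 / (L - 2)) + i * (1 / (L - 1)))
    (t : ℕ) :
    (Finset.univ.filter fun c => a c = t).card =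
      if t = 1 then i else if t = 2 then 2 else if t = m then 1 else 0 := by
  obtain ⟨hm2, hle⟩ := size_le_of_card_le ha hC h1 hsum
  have hmR : (3 : ℝ) ≤ m := by exact_mod_cast hm3
  have hid := sum_size_div_sub hm h2 hle hsum
  rw [← heq, sub_self] at hid
  have p1 : (0 : ℝ) ≤ Fintype.card C - (i + 3) := by
    rw [sub_nonneg]
    exact_mod_cast hC
  have p2 : (0 : ℝ) ≤ i - (Finset.univ.filter fun c => a c = 1).card := by
    rw [sub_nonneg]
    exact_mod_cast h1
  have q1 := chord_intercept_pos (m := m) (by linarith) hm h2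
  have q2 := chord_delta_pos (m := m) (by linarith) hm h2
  have p3 := Finset.sum_nonneg fun c (_ : c ∈ Finset.univ) =>
    chord_term_nonneg hm h2 (ha c) (hle c)
  have r1 := mul_nonneg p1 q1.le
  have r2 := mul_nonneg p2 q2.le
  have z1 : (Fintype.card C : ℝ) - (i + 3) = 0 := by
    refine (mul_eq_zero.1 (le_antisymm ?_ r1)).resolve_right q1.ne'
    linarith
  have z2 : (i : ℝ) - (Finset.univ.filter fun c => a c = 1).card = 0 := by
    refine (mul_eq_zero.1 (le_antisymm ?_ r2)).resolve_right q2.ne'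
    linarith
  have z3 := (Finset.sum_eq_zero_iff_of_nonneg fun c (_ : c ∈ Finset.univ) =>
    chord_term_nonneg hm h2 (ha c) (hle c)).1 (le_antisymm (by linarith) p3)
  have hcard : Fintype.card C = i + 3 := by
    rw [sub_eq_zero] at z1
    exact_mod_cast z1
  have hone : (Finset.univ.filter fun c => a c = 1).card = i := by
    rw [sub_eq_zero] at z2
    exact_mod_cast z2.symm
  have hval : ∀ c, a c = 1 ∨ a c = 2 ∨ a c = m := by
    intro c
    by_cases hc : a c = 1
    · exact Or.inl hc
    have hz := z3 c (Finset.mem_univ c)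
    rw [if_neg hc, add_zero] at hz
    have hac : (a c : ℝ) ≤ m := by exact_mod_cast hle c
    rw [div_eq_zero_iff, or_iff_left (mul_pos (mul_pos (by linarith) (by linarith))
      (by linarith) : (0 : ℝ) < (L - m) * (L - 2) * (L - a c)).ne', mul_eq_zero, mul_eq_zero,
      or_iff_right (by linarith : L ≠ 0), sub_eq_zero, sub_eq_zero] at hz
    rcases hz with hz | hz
    · exact Or.inr (Or.inl (by exact_mod_cast hz))
    · exact Or.inr (Or.inr (by exact_mod_cast hz.symm))
  have hcount : ∀ φ : ℕ → ℕ, ∑ c, φ (a c) =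
      i * φ 1 + (Finset.univ.filter fun c => a c = 2).card * φ 2 +
        (Finset.univ.filter fun c => a c = m).card * φ m := by
    intro φ
    have : ∀ c, φ (a c) = (if a c = 1 then φ 1 else 0) + (if a c = 2 then φ 2 else 0) +
        (if a c = m then φ m else 0) := by
      intro c
      rcases hval c with h | h | h
      · simp [h, show 1 ≠ m by omega]
      · simp [h, show 2 ≠ m by omega]
      · simp [h, show m ≠ 1 by omega, show m ≠ 2 by omega]
    rw [Finset.sum_congr rfl fun c _ => this c, Finset.sum_add_distrib, Finset.sum_add_distrib,
      ← Finset.sum_filter, ← Finset.sum_filter, ← Finset.sum_filter]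
    simp [hone]
  have hs1 := hcount fun _ => 1
  have hs2 := hcount fun t => t
  rw [hsum] at hs2
  simp only [Finset.sum_const, Finset.card_univ, smul_eq_mul, mul_one, hcard] at hs1 hs2
  obtain ⟨hq, hr⟩ : (Finset.univ.filter fun c => a c = 2).card = 2 ∧
      (Finset.univ.filter fun c => a c = m).card = 1 := by
    generalize (Finset.univ.filter fun c => a c = 2).card = q at *
    generalize (Finset.univ.filter fun c => a c = m).card = r at *
    have hr3 : r ≤ 3 := by omega
    interval_cases r <;> omega
  split_ifs with t1 t2 t3
  · rw [t1, hone]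
  · rw [t2, hq]
  · rw [t3, hr]
  · rw [Finset.card_eq_zero, Finset.filter_eq_empty_iff]
    intro c _ hc
    rcases hval c with h | h | h <;> omega

end Sizes

universe u

/-! ### From a missing spanning tree to clusters, and the obstruction in clusters. -/

section Components
variable {V : Type*} [Fintype V] {k : ℕ}

/-- A nonempty `X` is not covered by its neighbourhood, which lies in `S`, so it is admissible in
the binding number. -/
theorem IsBinding.ncard_le {G : SimpleGraph V} (hk : 3 ≤ k)
    (hG : IsBinding (1 / ((k : ℝ) - 2)) G) {S : Finset V} {X : Set V}
    (hXS : nbhd G X ⊆ S) (hX : Disjoint X (S : Set V)) : X.ncard ≤ (k - 2) * S.card := by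
  rcases X.eq_empty_or_nonempty with rfl | ⟨x, hx⟩
  · simp
  have : Nonempty V := ⟨x⟩
  have hne : nbhd G X ≠ Set.univ := fun h =>
    Set.disjoint_left.1 hX hx (hXS (h ▸ Set.mem_univ x))
  have h1 : 1 / ((k : ℝ) - 2) ≤ ((nbhd G X).ncard : ℝ) / (X.ncard : ℝ) :=
    le_trans hG ((isLeast_bindingNumber G).2 ⟨X, ⟨x, hx⟩, hne, rfl⟩)
  have h2 : (nbhd G X).ncard ≤ S.card := by
    rw [← Set.ncard_coe_finset]
    exact Set.ncard_le_ncard hXS (Set.toFinite _)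
  have h3 : (0 : ℝ) < X.ncard := by
    exact_mod_cast (Set.ncard_pos (Set.toFinite _)).2 ⟨x, hx⟩
  have h4 : (3 : ℝ) ≤ k := by exact_mod_cast hk
  rw [div_le_div_iff₀ (by linarith) h3, one_mul] at h1
  have h5 : (X.ncard : ℝ) ≤ ((k - 2) * (nbhd G X).ncard : ℕ) := by
    rw [Nat.cast_mul, Nat.cast_sub (by omega)]
    push_cast
    linarith
  exact (by exact_mod_cast h5 : X.ncard ≤ (k - 2) * (nbhd G X).ncard).trans
    (Nat.mul_le_mul_left _ h2)

open Classical in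
/-- A connected binding graph without a spanning `k`-tree is contained in a cluster join with many
classes, few of which are singletons. -/
theorem exists_le_clusterJoin {V : Type u} [Fintype V] {G : SimpleGraph V} (hk : 3 ≤ k)
    (hG : G.Connected)
    (hbind : IsBinding (1 / ((k : ℝ) - 2)) G) (htree : ¬ HasSpanningKTree k G) :
    ∃ (C : Type u) (_ : Fintype C) (f : V → Option C), G ≤ clusterJoin f ∧
      1 ≤ classCard f none ∧ (∀ c, 1 ≤ classCard f (some c)) ∧
      (k - 2) * classCard f none + 3 ≤ Fintype.card C ∧
      (Finset.univ.filter fun c => classCard f (some c) = 1).card ≤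
        (k - 2) * classCard f none := by
  obtain ⟨S, hS, hcard⟩ := exists_card_connectedComponent_of_not_hasSpanningKTree hG htree
  set H := avoid G (S : Set V)
  let C := {c : H.ConnectedComponent // ∃ v ∉ S, H.connectedComponentMk v = c}
  let f : V → Option C := fun v =>
    if h : v ∈ S then none else some ⟨H.connectedComponentMk v, v, h, rfl⟩
  have hf0 : ∀ v, f v = none ↔ v ∈ S := by
    intro v
    by_cases h : v ∈ S <;> simp [f, h]
  have hfs : ∀ v (h : v ∉ S), f v = some ⟨H.connectedComponentMk v, v, h, rfl⟩ := by
    intro v h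
    simp [f, h]
  have hle : G ≤ clusterJoin f := by
    intro a b hab
    refine ⟨hab.ne, ?_⟩
    by_cases ha : a ∈ S
    · exact Or.inl ((hf0 a).2 ha)
    by_cases hb : b ∈ S
    · exact Or.inr (Or.inl ((hf0 b).2 hb))
    refine Or.inr (Or.inr ?_)
    rw [hfs a ha, hfs b hb, Option.some_inj, Subtype.mk.injEq]
    exact ConnectedComponent.sound (Adj.reachable ⟨hab, ha, hb⟩)
  have hnone : classCard f none = S.card := by
    rw [classCard]
    congr 1
    ext v
    simp [hf0]
  have hsurj : ∀ c : C, ∃ v, f v = some c := by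
    rintro ⟨c, v, hv, rfl⟩
    exact ⟨v, hfs v hv⟩
  refine ⟨C, inferInstance, f, hle, ?_, ?_, ?_, ?_⟩
  · rw [hnone]
    exact hS.card_pos
  · intro c
    obtain ⟨v, hv⟩ := hsurj c
    exact Finset.card_pos.2 ⟨v, by simpa using hv⟩
  -- `H` keeps the vertices of `S` as isolated components, so at most $|S|$ components are lost in
  -- `C`.
  · have h1 : Nat.card H.ConnectedComponent ≤ Nat.card (C ⊕ S) := by
      refine Nat.card_le_card_of_surjective
        (Sum.elim (fun c => c.1) fun v => H.connectedComponentMk v) ?_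
      intro c
      obtain ⟨v, rfl⟩ := c.exists_rep
      by_cases hv : v ∈ S
      · exact ⟨Sum.inr ⟨v, hv⟩, rfl⟩
      · exact ⟨Sum.inl ⟨H.connectedComponentMk v, v, hv, rfl⟩, rfl⟩
    rw [Nat.card_sum, Nat.card_eq_fintype_card (α := C), Nat.card_eq_fintype_card (α := S),
      Fintype.card_coe] at h1
    rw [hnone, Nat.sub_mul]
    have h2 : 2 * S.card ≤ k * S.card := Nat.mul_le_mul_right _ (by omega)
    omega
  · rw [hnone]
    -- A vertex alone in its class has neighbours only in `S`; the binding hypothesis is applied to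
    -- the set of these.
    let X : Set V := {v | ∃ c, f v = some c ∧ classCard f (some c) = 1}
    have hXS : nbhd G X ⊆ S := by
      intro w hw
      simp only [nbhd, Set.mem_iUnion, mem_neighborSet, exists_prop] at hw
      obtain ⟨x, ⟨c, hc, hc1⟩, hxw⟩ := hw
      rcases (hle hxw).2 with h | h | h
      · simp [hc] at h
      · exact (hf0 w).1 h
      · obtain ⟨y, hy⟩ := Finset.card_eq_one.1 hc1
        have h1 : x ∈ ({y} : Finset V) := hy ▸ by simpa using hc
        have h2 : w ∈ ({y} : Finset V) := hy ▸ by simpa using h ▸ hc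
        rw [Finset.mem_singleton] at h1 h2
        exact absurd (h1.trans h2.symm) hxw.ne
    have hX : Disjoint X (S : Set V) := by
      rw [Set.disjoint_left]
      rintro x ⟨c, hc, -⟩ hx
      rw [(hf0 x).2 hx] at hc
      exact absurd hc (by simp)
    refine le_trans ?_ (hbind.ncard_le hk hXS hX)
    choose r hr using hsurj
    rw [← Set.ncard_coe_finset]
    refine Set.ncard_le_ncard_of_injOn r ?_ ?_ (Set.toFinite _)
    · intro c hc
      exact ⟨c, hr c, by simpa using hc⟩
    · intro c _ d _ hcd
      have := hr c
      rw [hcd, hr d] at this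
      exact (Option.some_inj.1 this).symm

/-- A tree path from a class to the only full vertex can leave the class only at that vertex, which
therefore has a tree neighbour in every class. -/
theorem not_hasSpanningKTree_clusterJoin {C : Type*} [Fintype C] {f : V → Option C}
    (h0 : classCard f none = 1) (hpos : ∀ c, 1 ≤ classCard f (some c))
    (hC : k < Fintype.card C) : ¬ HasSpanningKTree k (clusterJoin f) := by
  classical
  rintro ⟨T, hT, htree, hdeg⟩
  obtain ⟨v, hv⟩ := Finset.card_eq_one.1 h0
  have hv' : ∀ w, f w = none ↔ w = v := by
    intro w
    simpa using Finset.ext_iff.1 hv w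
  have hnb : ∀ c, ∃ w, T.Adj v w ∧ f w = some c := by
    intro c
    obtain ⟨u, hu⟩ := Finset.card_pos.1 (hpos c)
    obtain ⟨p⟩ := htree.connected.preconnected u v
    obtain ⟨d, -, hd1, hd2⟩ := p.exists_boundary_dart {w | f w = some c} (by simpa using hu)
      (by simp [(hv' v).2 rfl])
    have hd1' : f d.fst = some c := hd1
    rcases (hT d.adj).2 with h | h | h
    · simp [hd1'] at h
    · refine ⟨d.fst, ?_, hd1⟩
      rw [← (hv' _).1 h]
      exact d.adj.symm
    · exact absurd (h ▸ hd1' : f d.snd = some c) hd2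
  choose r hr hrf using hnb
  have h1 : Fintype.card C ≤ T.degree v := by
    rw [← card_neighborFinset_eq_degree, ← Finset.card_univ]
    refine Finset.card_le_card_of_injOn r (fun c _ => by simpa using hr c) ?_
    intro c _ d _ hcd
    have := hrf c
    rw [hcd, hrf d] at this
    exact (Option.some_inj.1 this).symm
  have h2 := hdeg v
  have h3 : T.degree v ≤ k := by convert h2
  omega

theorem HasSpanningKTree.of_iso {W : Type*} [Fintype W] {G : SimpleGraph V} {H : SimpleGraph W}
    (e : G ≃g H) (h : HasSpanningKTree k G) : HasSpanningKTree k H := by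
  classical
  obtain ⟨T, hT, htree, hdeg⟩ := h
  let i : T ≃g T.map e.toEquiv.toEmbedding := Iso.map e.toEquiv T
  refine ⟨T.map e.toEquiv.toEmbedding, ?_, i.isTree_iff.1 htree, ?_⟩
  · rintro a b ⟨-, x, y, hxy, rfl, rfl⟩
    exact e.map_adj_iff.2 (hT hxy)
  · intro w
    obtain ⟨v, rfl⟩ := i.surjective w
    refine le_trans (le_of_eq ?_) (hdeg v)
    rw [← ncard_neighborSet_eq_degree, ← ncard_neighborSet_eq_degree, ← Nat.card_coe_set_eq,
      ← Nat.card_coe_set_eq]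
    exact Nat.card_congr (i.mapNeighborSet v).symm

end Components

/-! ### The extremal graph as a cluster join. -/

section Extremal
variable (n k : ℕ)

/-- The colouring of the vertices of the extremal graph by the components left after deleting the
central vertex. -/
def extremalColour :
    Fin 1 ⊕ ((Fin (n - k - 3) ⊕ (Fin 2 × Fin 2)) ⊕ (Fin (k - 2) × Fin 1)) →
      Option (Unit ⊕ (Fin 2 ⊕ Fin (k - 2)))
  | .inl _ => none
  | .inr (.inl (.inl _)) => some (.inl ())
  | .inr (.inl (.inr p)) => some (.inr (.inl p.1))
  | .inr (.inr p) => some (.inr (.inr p.1))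

theorem extremalGraph_eq_clusterJoin :
    extremalGraph n k = clusterJoin (extremalColour n k) := by
  ext a b
  rcases a with a | ((a | a) | a) <;> rcases b with b | ((b | b) | b) <;>
    simp [extremalGraph, join, copies, clusterJoin_adj, extremalColour, Prod.ext_iff] <;> tauto

theorem classCard_eq_sum {V C : Type*} [Fintype V] [DecidableEq C] (f : V → Option C)
    (o : Option C) : classCard f o = ∑ v, if f v = o then 1 else 0 := by
  rw [classCard, Finset.card_filter]
  exact Finset.sum_congr rfl fun v _ => by congr

theorem classCard_extremalColour_none : classCard (extremalColour n k) none = 1 := by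
  simp [classCard_eq_sum, Fintype.sum_sum_type, extremalColour]

theorem classCard_extremalColour_inl (u : Unit) :
    classCard (extremalColour n k) (some (.inl u)) = n - k - 3 := by
  simp [classCard_eq_sum, Fintype.sum_sum_type, extremalColour]

theorem classCard_extremalColour_inr_inl (j : Fin 2) :
    classCard (extremalColour n k) (some (.inr (.inl j))) = 2 := by
  simp [classCard_eq_sum, Fintype.sum_sum_type, extremalColour, Fintype.sum_prod_type,
    -Finset.sum_boole]
  fin_cases j <;> rfl

theorem classCard_extremalColour_inr_inr (j : Fin (k - 2)) :
    classCard (extremalColour n k) (some (.inr (.inr j))) = 1 := by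
  simp [classCard_eq_sum, Fintype.sum_sum_type, extremalColour, Fintype.sum_prod_type,
    -Finset.sum_boole]

end Extremal

/-! ### The extremal equation, and the estimate for several full vertices. -/

section Numeric

/-- Intermediate value theorem: at $L=m+1$ the first term alone equals $L-1$, and at $L=m+i+6$ the
left side is at most $m+3$. The strict bound $L-1>m$ is what rules out several full vertices. -/
theorem exists_root {m i : ℕ} (hm : 2 ≤ m) (hi : 1 ≤ i) :
    ∃ L : ℝ, (m : ℝ) + 1 < L ∧
      (m : ℝ) / (L - m) + 2 * (2 / (L - 2)) + i * (1 / (L - 1)) = L - 1 := by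
  have hmR : (2 : ℝ) ≤ m := by exact_mod_cast hm
  have hiR : (1 : ℝ) ≤ i := by exact_mod_cast hi
  let g : ℝ → ℝ := fun L => (m : ℝ) / (L - m) + 2 * (2 / (L - 2)) + i * (1 / (L - 1)) - (L - 1)
  have hcont : ContinuousOn g (Set.Icc ((m : ℝ) + 1) (m + i + 6)) := by
    have h1 : ∀ L ∈ Set.Icc ((m : ℝ) + 1) (m + i + 6), L - m ≠ 0 := fun L hL => by
      linarith [hL.1]
    have h2 : ∀ L ∈ Set.Icc ((m : ℝ) + 1) (m + i + 6), L - 2 ≠ 0 := fun L hL => by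
      linarith [hL.1]
    have h3 : ∀ L ∈ Set.Icc ((m : ℝ) + 1) (m + i + 6), L - 1 ≠ 0 := fun L hL => by
      linarith [hL.1]
    fun_prop (disch := assumption)
  have hleft : 0 < g (m + 1) := by
    have h1 : (0 : ℝ) < 2 * (2 / ((m : ℝ) + 1 - 2)) :=
      mul_pos two_pos (div_pos two_pos (by linarith))
    have h2 : (0 : ℝ) < i * (1 / ((m : ℝ) + 1 - 1)) :=
      mul_pos (by linarith) (div_pos one_pos (by linarith))
    have h3 : (m : ℝ) / ((m : ℝ) + 1 - m) = m := by
      rw [add_sub_cancel_left, div_one]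
    simp only [g, h3]
    linarith
  have hright : g (m + i + 6) ≤ 0 := by
    have h1 : (m : ℝ) / ((m : ℝ) + i + 6 - m) ≤ m := div_le_self (by linarith) (by linarith)
    have h2 : (2 : ℝ) / ((m : ℝ) + i + 6 - 2) ≤ 1 := by
      rw [div_le_one (by linarith)]
      linarith
    have h3 : (i : ℝ) * (1 / ((m : ℝ) + i + 6 - 1)) ≤ 1 := by
      rw [mul_one_div, div_le_one (by linarith)]
      linarith
    simp only [g]
    linarith
  obtain ⟨L, hL, h0⟩ := intermediate_value_Icc' (by linarith) hcont
    (show (0 : ℝ) ∈ Set.Icc (g (m + i + 6)) (g (m + 1)) from ⟨hright, hleft.le⟩)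
  refine ⟨L, lt_of_le_of_ne hL.1 ?_, sub_eq_zero.1 h0⟩
  rintro rfl
  exact hleft.ne' h0

/-- In the application $l=n-k-3$, $t=k-1$, $p=s-1$ and $L=l+1$. The large class has size $m=l-tp$,
`hl` is $n\ge2k+22$ and `hm` is $m\ge2$. With $q=(l+1)/(tp+1)$ one has $(p+1)q+(t-1)pq=l+1$, so the
small classes only have to fit into $(t-1)pq$. -/
theorem supersolution_bound {l t p : ℝ} (ht : 2 ≤ t) (hp : 1 ≤ p) (hl : t + 20 ≤ l)
    (hm : t * p + 2 ≤ l) :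
    p + (p + 1) * ((l - t * p) / (t * p + 1) + 2 * (2 / (l - 1)) +
      (t - 1) * (p + 1) * (1 / l)) ≤ l := by
  have hu : 0 < t * p + 1 := by positivity
  have hl0 : 0 < l := by linarith
  -- Here $26/5=1+21/5$, where $21/5$ pays for the two classes of size $2$. For $p\le t+9$ the
  -- factor $l+1$ is bounded by `hl`, for larger $p$ by `hm`.
  have key : (p + 1) * (p + 26 / 5) * (t * p + 1) ≤ p * l * (l + 1) := by
    rcases le_total p (t + 9) with h | h
    · have h1 : (p + 1) * (p + 26 / 5) ≤ p * (t + 21) := by nlinarith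
      calc (p + 1) * (p + 26 / 5) * (t * p + 1) ≤ p * (t + 21) * l :=
            mul_le_mul h1 (by linarith) hu.le (by positivity)
        _ = p * l * (t + 21) := by ring
        _ ≤ p * l * (l + 1) := mul_le_mul_of_nonneg_left (by linarith) (by positivity)
    · have h1 : (p + 1) * (p + 26 / 5) ≤ p * (t * p + 3) := by
        have h2 : p * (2 * p + 3) ≤ p * (t * p + 3) := by gcongr
        nlinarith
      calc (p + 1) * (p + 26 / 5) * (t * p + 1) ≤ p * (t * p + 3) * l :=
            mul_le_mul h1 (by linarith) hu.le (by positivity)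
        _ = p * l * (t * p + 3) := by ring
        _ ≤ p * l * (l + 1) := mul_le_mul_of_nonneg_left (by linarith) (by positivity)
  have h1 : (l - t * p) / (t * p + 1) = (l + 1) / (t * p + 1) - 1 := by
    field_simp
    ring
  have h2 : 2 * (2 / (l - 1)) ≤ 21 / 5 * (1 / l) := by
    rw [mul_one_div, ← mul_div_assoc, div_le_div_iff₀ (by linarith) hl0]
    linarith
  have h3 : (p + 1) * (21 / 5 * (1 / l) + (t - 1) * (p + 1) * (1 / l)) ≤
      (t - 1) * p * ((l + 1) / (t * p + 1)) := by
    have e1 : (p + 1) * (21 / 5 * (1 / l) + (t - 1) * (p + 1) * (1 / l)) =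
        (p + 1) * (21 / 5 + (t - 1) * (p + 1)) / l := by ring
    have e2 : (t - 1) * p * ((l + 1) / (t * p + 1)) =
        (t - 1) * p * (l + 1) / (t * p + 1) := by ring
    rw [e1, e2, div_le_div_iff₀ hl0 hu]
    have h4 : (p + 1) * (21 / 5 + (t - 1) * (p + 1)) ≤ (t - 1) * ((p + 1) * (p + 26 / 5)) := by
      nlinarith
    calc (p + 1) * (21 / 5 + (t - 1) * (p + 1)) * (t * p + 1)
        ≤ (t - 1) * ((p + 1) * (p + 26 / 5)) * (t * p + 1) := by gcongr
      _ = (t - 1) * ((p + 1) * (p + 26 / 5) * (t * p + 1)) := by ring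
      _ ≤ (t - 1) * (p * l * (l + 1)) := mul_le_mul_of_nonneg_left key (by linarith)
      _ = (t - 1) * p * (l + 1) * l := by ring
  have h5 : (p + 1) * ((l + 1) / (t * p + 1)) + (t - 1) * p * ((l + 1) / (t * p + 1)) = l + 1 := by
    field_simp
    ring
  have h6 := mul_le_mul_of_nonneg_left h2 (by linarith : 0 ≤ p + 1)
  rw [h1]
  nlinarith

end Numeric

/-! ### Comparison with the extremal graph. -/

section Main

theorem sum_classCard_extremalColour (n k : ℕ) (φ : ℕ → ℝ) :
    ∑ c, φ (classCard (extremalColour n k) (some c)) =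
      φ (n - k - 3) + 2 * φ 2 + (k - 2 : ℕ) * φ 1 := by
  simp [Fintype.sum_sum_type, classCard_extremalColour_inl, classCard_extremalColour_inr_inl,
    classCard_extremalColour_inr_inr]
  ring

theorem card_classCard_extremalColour {n k : ℕ} (h : 3 ≤ n - k - 3) (t : ℕ) :
    Nat.card {c // classCard (extremalColour n k) (some c) = t} =
      if t = 1 then k - 2 else if t = 2 then 2 else if t = n - k - 3 then 1 else 0 := by
  classical
  rw [Nat.card_eq_fintype_card, Fintype.card_subtype, Finset.card_filter]
  simp only [Fintype.sum_sum_type, classCard_extremalColour_inl, classCard_extremalColour_inr_inl,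
    classCard_extremalColour_inr_inr, Finset.sum_const, Finset.card_univ, Fintype.card_unit,
    Fintype.card_fin, smul_eq_mul]
  split_ifs <;> omega

/-- For a root `L` the test vector satisfies the eigenvalue equation at the centre too. Only this
lower bound on the radius is needed. -/
theorem le_rho_extremalGraph {n k : ℕ} {L : ℝ} (hL : ((n - k - 3 : ℕ) : ℝ) + 1 < L)
    (h2 : 2 < L)
    (heq : ((n - k - 3 : ℕ) : ℝ) / (L - (n - k - 3 : ℕ)) + 2 * (2 / (L - 2)) +
      (k - 2 : ℕ) * (1 / (L - 1)) = L - 1) :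
    L - 1 ≤ rho (extremalGraph n k) := by
  refine (isGreatest_rho (extremalGraph n k)).2 (mem_adjEigenvalues_iff.2
    ⟨fun v => clusterVector (extremalColour n k) L (extremalColour n k v), ?_, ?_⟩)
  · intro h
    have := congrFun h (Sum.inl 0)
    simp [extremalColour, clusterVector] at this
  · intro v
    rw [extremalGraph_eq_clusterJoin]
    beta_reduce
    cases hv : extremalColour n k v with
    | none =>
      have hsum := sum_classCard_extremalColour n k fun t => (t : ℝ) / (L - t)
      rw [adjSum_clusterVector_none hv, classCard_extremalColour_none, hsum]
      simp only [Nat.cast_one, Nat.cast_ofNat, clusterVector]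
      rw [heq]
      ring
    | some c =>
      rw [← hv, adjSum_clusterVector_some hv]
      rcases c with ⟨⟩ | j | j
      · rw [classCard_extremalColour_inl]
        linarith
      · rw [classCard_extremalColour_inr_inl]
        exact_mod_cast h2
      · rw [classCard_extremalColour_inr_inr]
        push_cast
        linarith

theorem adjSum_clusterVector_le {V C : Type*} [Fintype V] [Fintype C] {f : V → Option C} {L : ℝ}
    (hL : ∀ c, (classCard f (some c) : ℝ) < L)
    (hsum : (classCard f none : ℝ) - 1 +
      classCard f none * ∑ c, (classCard f (some c) : ℝ) / (L - classCard f (some c)) ≤ L - 1)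
    (v : V) :
    adjSum (clusterJoin f) (fun w => clusterVector f L (f w)) v ≤
      (L - 1) * clusterVector f L (f v) := by
  cases hv : f v with
  | none =>
    rw [adjSum_clusterVector_none hv]
    simpa [clusterVector] using hsum
  | some c => rw [adjSum_clusterVector_some hv (hL c), hv]

open Classical in
/-- A graph inside a cluster join with at least two full vertices has small spectral radius. -/
theorem rho_le_of_two_le {V C : Type*} [Fintype V] [Fintype C] [Nonempty V] {f : V → Option C}
    {n k m : ℕ} {G : SimpleGraph V} (hk : 3 ≤ k) (hn : 2 * k + 22 ≤ n)
    (hle : G ≤ clusterJoin f) (hs : 2 ≤ classCard f none)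
    (hpos : ∀ c, 1 ≤ classCard f (some c))
    (hC : (k - 2) * classCard f none + 3 ≤ Fintype.card C)
    (h1 : (Finset.univ.filter fun c => classCard f (some c) = 1).card ≤
      (k - 2) * classCard f none)
    (hsum : ∑ c, classCard f (some c) = m + 4 + (k - 2) * classCard f none)
    (hm : classCard f none + (m + 4 + (k - 2) * classCard f none) = n) :
    rho G ≤ ((n - k - 3 : ℕ) : ℝ) := by
  obtain ⟨hm2, hcm⟩ := size_le_of_card_le hpos hC h1 hsum
  obtain ⟨p, hp⟩ := Nat.exists_eq_add_of_le' (show 1 ≤ classCard f none by omega)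
  obtain ⟨j, rfl⟩ := Nat.exists_eq_add_of_le' hk
  set l : ℝ := ((n - (j + 3) - 3 : ℕ) : ℝ) with hl
  have hlval : l = n - j - 6 := by
    rw [hl, Nat.sub_sub, Nat.cast_sub (by omega)]
    push_cast
    ring
  have hnR : (2 : ℝ) * (j + 3) + 22 ≤ n := by exact_mod_cast hn
  have hpR : (1 : ℝ) ≤ p := by exact_mod_cast (by omega : 1 ≤ p)
  have hjR : (0 : ℝ) ≤ j := Nat.cast_nonneg j
  have hm2R : (2 : ℝ) ≤ m := by exact_mod_cast hm2
  have hij : ((j + 3 - 2) * classCard f none : ℕ) = (j + 1) * (p + 1) := by rw [hp]; rfl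
  rw [hij] at hC h1 hsum hm
  have hmR : (m : ℝ) = l - (j + 2) * p := by
    have h3 : (((p + 1) + (m + 4 + (j + 1) * (p + 1)) : ℕ) : ℝ) = n := by
      exact_mod_cast hp ▸ hm
    push_cast at h3
    rw [hlval]
    linarith
  have hjp : (0 : ℝ) ≤ (j + 2) * p := by positivity
  have hmL : (m : ℝ) < l + 1 := by linarith
  have hcL : ∀ c, (classCard f (some c) : ℝ) < l + 1 := fun c =>
    lt_of_le_of_lt (by exact_mod_cast hcm c) hmL
  have hS := sum_size_div_le (L := l + 1) hpos hC h1 hsum hmL (by linarith)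
  have hbound := supersolution_bound (l := l) (t := j + 2) (p := p) (by linarith) hpR
    (by linarith) (by linarith)
  have hsol : (classCard f none : ℝ) - 1 + classCard f none *
      ∑ c, (classCard f (some c) : ℝ) / (l + 1 - classCard f (some c)) ≤ l + 1 - 1 := by
    have hpc : (classCard f none : ℝ) = p + 1 := by rw [hp]; push_cast; ring
    rw [hpc]
    have h3 := mul_le_mul_of_nonneg_left hS (by linarith : (0 : ℝ) ≤ p + 1)
    have e1 : (m : ℝ) / (l + 1 - m) = (l - (j + 2) * p) / ((j + 2) * p + 1) := by
      rw [hmR]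
      congr 1
      ring
    have e2 : l + 1 - 2 = l - 1 := by ring
    rw [e1, e2, add_sub_cancel_right] at h3
    push_cast at h3
    have e3 : ((j : ℝ) + 2 - 1) * (p + 1) = (j + 1) * (p + 1) := by ring
    rw [e3] at hbound
    linarith
  have := eigenvalue_le_of_supersolution hle (fun v => clusterVector_pos (by omega) hcL (f v))
    (adjSum_clusterVector_le hcL hsol) (isGreatest_rho G).1
  linarith

open Classical in
/-- With a single full vertex, only the extremal graph reaches the extremal spectral radius. -/
theorem nonempty_iso_extremalGraph {V C : Type*} [Fintype V] [Fintype C] [Nonempty V]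
    {f : V → Option C} {n k : ℕ} {L : ℝ} {G : SimpleGraph V} (hG : G.Connected)
    (hm3 : 3 ≤ n - k - 3) (hL : ((n - k - 3 : ℕ) : ℝ) + 1 < L)
    (heq : ((n - k - 3 : ℕ) : ℝ) / (L - (n - k - 3 : ℕ)) + 2 * (2 / (L - 2)) +
      (k - 2 : ℕ) * (1 / (L - 1)) = L - 1)
    (hle : G ≤ clusterJoin f) (hs : classCard f none = 1)
    (hpos : ∀ c, 1 ≤ classCard f (some c)) (hC : k - 2 + 3 ≤ Fintype.card C)
    (h1 : (Finset.univ.filter fun c => classCard f (some c) = 1).card ≤ k - 2)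
    (hsum : ∑ c, classCard f (some c) = n - k - 3 + 4 + (k - 2)) (hrho : L - 1 ≤ rho G) :
    Nonempty (G ≃g extremalGraph n k) := by
  obtain ⟨-, hcm⟩ := size_le_of_card_le hpos hC h1 hsum
  have hm3R : (3 : ℝ) ≤ (n - k - 3 : ℕ) := by exact_mod_cast hm3
  have hcL : ∀ c, (classCard f (some c) : ℝ) < L := fun c =>
    lt_of_le_of_lt (by exact_mod_cast hcm c) (by linarith : ((n - k - 3 : ℕ) : ℝ) < L)
  have hS := sum_size_div_le (L := L) hpos hC h1 hsum (by linarith) (by linarith)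
  rw [heq] at hS
  have hsol : (classCard f none : ℝ) - 1 + classCard f none *
      ∑ c, (classCard f (some c) : ℝ) / (L - classCard f (some c)) ≤ L - 1 := by
    rw [hs]
    push_cast
    linarith
  obtain ⟨hGeq, hMx⟩ := eq_of_supersolution hG hle
    (fun v => clusterVector_pos (by omega) hcL (f v)) (adjSum_clusterVector_le hcL hsol)
    (isGreatest_rho G).1 hrho
  obtain ⟨v, hv⟩ : ∃ v, f v = none := by
    obtain ⟨v, hv⟩ := Finset.card_pos.1 (show 0 < classCard f none by omega)
    exact ⟨v, by simpa using hv⟩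
  -- The eigenvalue equation at the full vertex is exactly equality in the convexity bound, which
  -- determines the class sizes.
  have hSeq : ∑ c, (classCard f (some c) : ℝ) / (L - classCard f (some c)) = L - 1 := by
    have h3 := hMx v
    rw [adjSum_clusterVector_none hv, hv, hs] at h3
    simpa [clusterVector] using h3
  rw [hGeq, extremalGraph_eq_clusterJoin]
  refine nonempty_iso_clusterJoin (by rw [hs, classCard_extremalColour_none]) fun t => ?_
  rw [card_classCard_extremalColour hm3, Nat.card_eq_fintype_card, Fintype.card_subtype]
  exact card_size_of_sum_eq hpos hC h1 hsum (by linarith) (by linarith) hm3 (hSeq.trans heq.symm) t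

-- At least three classes are not singletons, so the total is at least $i+6$ and the size `m` of the
-- large part is well defined.
open Classical in
theorem exists_sum_eq {C : Type*} [Fintype C] {a : C → ℕ} {i : ℕ} (ha : ∀ c, 1 ≤ a c)
    (hC : i + 3 ≤ Fintype.card C) (h1 : (Finset.univ.filter fun c => a c = 1).card ≤ i) :
    ∃ m, ∑ c, a c = m + 4 + i := by
  have hsplit := Finset.card_filter_add_card_filter_not (s := (Finset.univ : Finset C))
    (fun c => a c = 1)
  have h2 : ∑ c : C, (1 + if ¬ a c = 1 then 1 else 0) ≤ ∑ c, a c := by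
    refine Finset.sum_le_sum fun c _ => ?_
    have := ha c
    split_ifs <;> omega
  rw [Finset.sum_add_distrib, Finset.sum_const, smul_eq_mul, mul_one, Finset.card_univ,
    ← Finset.card_filter] at h2
  rw [Finset.card_univ] at hsplit
  exact ⟨∑ c, a c - 4 - i, by omega⟩

end Main
end SpanningKTree

theorem theorem1p4 {V : Type*} [Fintype V] (k n : ℕ) (hk : 3 ≤ k)
    (hcard : Fintype.card V = n) (hn : 2 * k + 22 ≤ n)
    (G : SimpleGraph V) (hconn : G.Connected)
    (hbind : SpanningKTree.IsBinding (1 / ((k : ℝ) - 2)) G)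
    (hrho : SpanningKTree.rho (SpanningKTree.extremalGraph n k) ≤ SpanningKTree.rho G) :
    (¬ Nonempty (G ≃g SpanningKTree.extremalGraph n k) →
        SpanningKTree.HasSpanningKTree k G) ∧
      (Nonempty (G ≃g SpanningKTree.extremalGraph n k) →
        ¬ SpanningKTree.HasSpanningKTree k G) := by
  open SpanningKTree in
  constructor
  · intro hiso
    by_contra htree
    obtain ⟨C, _, f, hle, hs, hpos, hC, h1⟩ := exists_le_clusterJoin hk hconn hbind htree
    obtain ⟨m, hm⟩ := exists_sum_eq hpos hC h1
    have hV := card_eq_sum_classCard f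
    rw [hcard, hm] at hV
    have : Nonempty V := hconn.nonempty
    have hm3 : 3 ≤ n - k - 3 := by omega
    have hm3R : (3 : ℝ) ≤ (n - k - 3 : ℕ) := by exact_mod_cast hm3
    obtain ⟨L, hL, heq⟩ := exists_root (m := n - k - 3) (i := k - 2) (by omega) (by omega)
    have hLrho := (le_rho_extremalGraph hL (by linarith) heq).trans hrho
    by_cases hs1 : classCard f none = 1
    · rw [hs1, mul_one] at hC h1 hm hV
      have hmn : m = n - k - 3 := by omega
      exact hiso (nonempty_iso_extremalGraph hconn hm3 hL heq hle hs1 hpos hC h1 (hmn ▸ hm) hLrho)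
    -- This gives $\rho(G)\le n-k-3<L-1$, against `hLrho`.
    · have := rho_le_of_two_le hk hn hle (by omega) hpos hC h1 hm hV.symm
      linarith
  · rintro ⟨e⟩ htree
    have h := htree.of_iso e
    rw [extremalGraph_eq_clusterJoin] at h
    refine not_hasSpanningKTree_clusterJoin (classCard_extremalColour_none n k) ?_ ?_ h
    · rintro (⟨⟩ | j | j)
      · rw [classCard_extremalColour_inl]
        omega
      · rw [classCard_extremalColour_inr_inl]
        omega
      · rw [classCard_extremalColour_inr_inr]
    · simp only [Fintype.card_sum, Fintype.card_unit, Fintype.card_fin]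
      omega
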